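/- Let $N\ge 1$, let $\Omega\subset\mathbb R^N$ be a bounded domain (nonempty, open, connected; any bounded smooth domain is included, but no regularity of $\partial\Omega$ is needed), and let $1<p<\infty$. A weight is a measurable, a.e. positive function on $\Omega$. Write $w\in\mathcal A_p$ if $w$ is a weight with $w,\ w^{-1/(p-1)}\in L^1_{loc}(\Omega)$, and write $w\in\mathcal A_s$, where $s\ge \frac1{p-1}$, if $w\in\mathcal A_p$ and $w^{-s}\in L^1(\Omega)$; put $p_s=\frac{ps}{s+1}$. For $w\in\mathcal A_p$, let $W^{1,p}(\Omega,w)$ be the space of functions $u$ with weak gradient $\nabla u$ and finite norm $\|u\|_{1,p,w}=\big(\int_\Omega|u|^p\,dx+\int_\Omega w|\nabla u|^p\,dx\big)^{1/p}$, and let $W^{1,p}_0(\Omega,w)$ be the closure of $C_c^\infty(\Omega)$ in it. For $f\in L^1(\Omega)$, a (weak) solution of $$-\operatorname{div}\big(w|\nabla u|^{p-2}\nabla u\big)=f(x)|u|^{p-2}u\ \text{ in }\Omega,\qquad u=0\ \text{ on }\partial\Omega,$$ is a function $u\in W^{1,p}_0(\Omega,w)$ such that, for every $\psi\in W^{1,p}_0(\Omega,w)$,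 the function $f|u|^{p-2}u\,\psi$ is integrable on $\Omega$ and $$\int_\Omega w|\nabla u|^{p-2}\nabla u\cdot\nabla\psi\,dx=\int_\Omega f|u|^{p-2}u\,\psi\,dx .$$ **Theorem (Comparison Theorem).** Let $w_1\in\mathcal A_p$ and $w_2\in\mathcal A_s$ with $s\ge\frac1{p-1}$ and $p_s>N$, and suppose $w_2\le w_1$ a.e. in $\Omega$. Let $f_1,f_2\in L^1(\Omega)$ with $0\le f_1<f_2$ a.e. in $\Omega$. Assume that there is a solution $u\in W^{1,p}_0(\Omega,w_1)$ with $u\ge0$ a.e. and $u\not\equiv0$ of $$-\operatorname{div}\big(w_1|\nabla u|^{p-2}\nabla u\big)=f_1(x)|u|^{p-2}u\ \text{ in }\Omega,\qquad u=0\ \text{ on }\partial\Omega .$$ Then every nontrivial solution $v\in W^{1,p}_0(\Omega,w_2)$ of $$-\operatorname{div}\big(w_2|\nabla v|^{p-2}\nabla v\big)=f_2(x)|v|^{p-2}v\ \text{ in }\Omega,\qquad v=0\ \text{ on }\partial\Omega,$$ changes sign in $\Omega$, that is, both $\{x\in\Omega: v(x)>0\}$ and $\{x\in\Omega: v(x)<0\}$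 have positive Lebesgue measure. -/

import Mathlib

open MeasureTheory Filter Topology
open scoped ContDiff Gradient

/-- `a` is a weight on `Ω` (measurable and a.e. positive) of class `𝒜_p`:
`a ∈ L¹_loc(Ω)` and `a^{-1/(p-1)} ∈ L¹_loc(Ω)`. -/
structure IsWeightAp {N : ℕ} (Ω : Set (EuclideanSpace ℝ (Fin N))) (p : ℝ)
    (a : EuclideanSpace ℝ (Fin N) → ℝ) : Prop where
  aemeasurable : AEMeasurable a (volume.restrict Ω)
  pos : ∀ᵐ x ∂(volume.restrict Ω), 0 < a x
  locallyIntegrable : LocallyIntegrableOn a Ω volume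
  locallyIntegrable_rpow : LocallyIntegrableOn (fun x => a x ^ (-(1 / (p - 1)))) Ω volume

/-- `a` is a weight of class `𝒜_s`, with exponent `s`:
`a ∈ 𝒜_p`, `s ≥ 1/(p-1)` and `a^{-s} ∈ L¹(Ω)`. -/
structure IsWeightAs {N : ℕ} (Ω : Set (EuclideanSpace ℝ (Fin N))) (p s : ℝ)
    (a : EuclideanSpace ℝ (Fin N) → ℝ) : Prop where
  isWeightAp : IsWeightAp Ω p a
  le_exponent : 1 / (p - 1) ≤ s
  integrable_rpow : IntegrableOn (fun x => a x ^ (-s)) Ω volume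

/-- The exponent `p_s = p s / (s + 1)`. -/
noncomputable def expPs (p s : ℝ) : ℝ := p * s / (s + 1)

/-- `φ ∈ C_c^∞(Ω)`. -/
structure IsTestFunction {N : ℕ} (Ω : Set (EuclideanSpace ℝ (Fin N)))
    (φ : EuclideanSpace ℝ (Fin N) → ℝ) : Prop where
  contDiff : ContDiff ℝ ∞ φ
  hasCompactSupport : HasCompactSupport φ
  tsupport_subset : tsupport φ ⊆ Ω

/-- The vector field `G` is the weak (distributional) gradient of `u` on `Ω`. -/
structure HasWeakGradient {N : ℕ} (Ω : Set (EuclideanSpace ℝ (Fin N)))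
    (u : EuclideanSpace ℝ (Fin N) → ℝ)
    (G : EuclideanSpace ℝ (Fin N) → EuclideanSpace ℝ (Fin N)) : Prop where
  locallyIntegrable : LocallyIntegrableOn u Ω volume
  locallyIntegrable_grad : LocallyIntegrableOn G Ω volume
  integral_eq : ∀ φ : EuclideanSpace ℝ (Fin N) → ℝ, IsTestFunction Ω φ → ∀ i : Fin N,
    ∫ x in Ω, u x * (∇ φ x) i = - ∫ x in Ω, (G x) i * φ x

/-- `u ∈ W^{1,p}(Ω, w)`, with weak gradient `G`: both `∫_Ω |u|^p` and `∫_Ω w |G|^p` are finite. -/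
structure MemWeightedSobolev {N : ℕ} (Ω : Set (EuclideanSpace ℝ (Fin N))) (p : ℝ)
    (w : EuclideanSpace ℝ (Fin N) → ℝ) (u : EuclideanSpace ℝ (Fin N) → ℝ)
    (G : EuclideanSpace ℝ (Fin N) → EuclideanSpace ℝ (Fin N)) : Prop where
  hasWeakGradient : HasWeakGradient Ω u G
  integrable : IntegrableOn (fun x => |u x| ^ p) Ω volume
  integrable_grad : IntegrableOn (fun x => w x * ‖G x‖ ^ p) Ω volume

/-- The norm `(∫_Ω |u|^p + ∫_Ω w |G|^p)^{1/p}` of a function `u` with gradient `G`. -/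
noncomputable def weightedSobolevNorm {N : ℕ} (Ω : Set (EuclideanSpace ℝ (Fin N))) (p : ℝ)
    (w : EuclideanSpace ℝ (Fin N) → ℝ) (u : EuclideanSpace ℝ (Fin N) → ℝ)
    (G : EuclideanSpace ℝ (Fin N) → EuclideanSpace ℝ (Fin N)) : ℝ :=
  ((∫ x in Ω, |u x| ^ p) + ∫ x in Ω, w x * ‖G x‖ ^ p) ^ (1 / p)

/-- `u ∈ W_0^{1,p}(Ω, w)`, with weak gradient `G`: `u` lies in the closure of `C_c^∞(Ω)` in
`W^{1,p}(Ω, w)`. -/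
structure MemWeightedSobolevZero {N : ℕ} (Ω : Set (EuclideanSpace ℝ (Fin N))) (p : ℝ)
    (w : EuclideanSpace ℝ (Fin N) → ℝ) (u : EuclideanSpace ℝ (Fin N) → ℝ)
    (G : EuclideanSpace ℝ (Fin N) → EuclideanSpace ℝ (Fin N)) : Prop where
  memWeightedSobolev : MemWeightedSobolev Ω p w u G
  exists_approx : ∃ φ : ℕ → EuclideanSpace ℝ (Fin N) → ℝ, (∀ n, IsTestFunction Ω (φ n)) ∧
    Tendsto (fun n => weightedSobolevNorm Ω p w (fun x => u x - φ n x)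
      (fun x => G x - ∇ (φ n) x)) atTop (𝓝 0)

/-- `u` is a weak solution of `-div (w |∇u|^{p-2} ∇u) = f |u|^{p-2} u` in `Ω`, `u = 0` on `∂Ω`:
`u ∈ W_0^{1,p}(Ω, w)`, and the integral identity holds for every test function
`ψ ∈ W_0^{1,p}(Ω, w)` (whose weak gradient is `H`). -/
def IsDirichletSolution {N : ℕ} (Ω : Set (EuclideanSpace ℝ (Fin N))) (p : ℝ)
    (w f : EuclideanSpace ℝ (Fin N) → ℝ) (u : EuclideanSpace ℝ (Fin N) → ℝ) : Prop :=
  ∃ G : EuclideanSpace ℝ (Fin N) → EuclideanSpace ℝ (Fin N),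
    MemWeightedSobolevZero Ω p w u G ∧
    ∀ (ψ : EuclideanSpace ℝ (Fin N) → ℝ)
      (H : EuclideanSpace ℝ (Fin N) → EuclideanSpace ℝ (Fin N)),
      MemWeightedSobolevZero Ω p w ψ H →
        IntegrableOn (fun x => f x * (|u x| ^ (p - 2) * u x) * ψ x) Ω volume ∧
        ∫ x in Ω, w x * (‖G x‖ ^ (p - 2) * inner ℝ (G x) (H x)) =
          ∫ x in Ω, f x * (|u x| ^ (p - 2) * u x) * ψ x

/-- `v` changes sign in `Ω`: it is positive on a set of positive measure and negative on a set of
positive measure. -/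
def ChangesSign {N : ℕ} (Ω : Set (EuclideanSpace ℝ (Fin N)))
    (v : EuclideanSpace ℝ (Fin N) → ℝ) : Prop :=
  0 < volume {x ∈ Ω | 0 < v x} ∧ 0 < volume {x ∈ Ω | v x < 0}

/-! If `v` did not change sign, then `v` or `-v` would be a nontrivial nonnegative solution, and
such a solution cannot coexist with `u`.

The contradiction is Picone's inequality. For `v > 0`, test the equation of `v` formally with `φ^p /
v^(p-1)`, `φ ≥ 0`. Young's inequality gives `|∇v|^(p-2) ∇v · ∇(φ^p / v^(p-1)) ≤ |∇φ|^p`, hence `∫ f₂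
φ^p ≤ ∫ w₂ |∇φ|^p ≤ ∫ w₁ |∇φ|^p`. Letting `φ` approach `u` and testing the equation of `u` with `u`
itself yields `∫ f₂ |u|^p ≤ ∫ w₁ |∇u|^p = ∫ f₁ |u|^p < ∞`. As `f₁ < f₂` a.e., this forces `u = 0`
a.e.

To make the test function admissible, `v` is replaced by `r(v) = √((v + a)² + b²)` and `φ^p` by
`√(φ² + σ²)^p - σ^p`. These are smooth expressions, and `r ≥ b` on all of `ℝ`, so
`MemWeightedSobolevZero.mul_comp` applies even though the functions approximating `v` may be
negative. `picone_estimate` is the resulting inequality, with explicit errors;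
`lintegral_mul_rpow_le` is its limit.

Positivity of `v` comes from the same estimate with a cutoff as `φ` and `a = b`: since `f₂ ≥ 0`, it
bounds `w₂ |∇v|^p / r(v)^p` locally in `L¹`, uniformly in `a`. This controls the gradient of
`arsinh((v + a)/a)`, so a Poincaré inequality on balls bounds its oscillation uniformly. If `v` were
zero on one part of a ball of positive measure and positive on another, the oscillation would blow
up as `a → 0`. Thus `v` is a.e. zero or a.e. positive on each small ball, and connectedness of `Ω`
makes the alternative global. -/

/-! ### Weighted measures, `L^p` norms and limit theorems -/

section Abstract

variable {α : Type*} [MeasurableSpace α] {μ : Measure α}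

/-- The measure `w μ` with a real density `w`. -/
noncomputable def weightedMeasure (μ : Measure α) (w : α → ℝ) : Measure α :=
  μ.withDensity fun x => ENNReal.ofReal (w x)

theorem weightedMeasure_absolutelyContinuous (μ : Measure α) (w : α → ℝ) :
    weightedMeasure μ w ≪ μ :=
  withDensity_absolutelyContinuous _ _

theorem absolutelyContinuous_weightedMeasure {w : α → ℝ} (hw : AEMeasurable w μ)
    (hpos : ∀ᵐ x ∂μ, 0 < w x) : μ ≪ weightedMeasure μ w :=
  withDensity_absolutelyContinuous' hw.ennreal_ofReal
    (hpos.mono fun _ hx => (ENNReal.ofReal_pos.2 hx).ne')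

theorem weightedMeasure_mono {w₁ w₂ : α → ℝ} (h : ∀ᵐ x ∂μ, w₁ x ≤ w₂ x) :
    weightedMeasure μ w₁ ≤ weightedMeasure μ w₂ :=
  withDensity_mono (h.mono fun _ hx => ENNReal.ofReal_le_ofReal hx)

theorem lintegral_weightedMeasure {w : α → ℝ} (hw : AEMeasurable w μ) {g : α → ENNReal}
    (hg : AEMeasurable g μ) :
    ∫⁻ x, g x ∂(weightedMeasure μ w) = ∫⁻ x, ENNReal.ofReal (w x) * g x ∂μ :=
  lintegral_withDensity_eq_lintegral_mul₀ hw.ennreal_ofReal hg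

theorem integrable_weightedMeasure_iff {w : α → ℝ} (hw : AEMeasurable w μ)
    (hpos : ∀ᵐ x ∂μ, 0 < w x) {g : α → ℝ} :
    Integrable g (weightedMeasure μ w) ↔ Integrable (fun x => w x * g x) μ := by
  rw [weightedMeasure, integrable_withDensity_iff_integrable_smul₀' hw.ennreal_ofReal
    (ae_of_all _ fun _ => ENNReal.ofReal_lt_top)]
  refine integrable_congr (hpos.mono fun x hx => ?_)
  simp [ENNReal.toReal_ofReal hx.le]

theorem integral_weightedMeasure {w : α → ℝ} (hw : AEMeasurable w μ)
    (hpos : ∀ᵐ x ∂μ, 0 < w x) (g : α → ℝ) :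
    ∫ x, g x ∂(weightedMeasure μ w) = ∫ x, w x * g x ∂μ := by
  rw [weightedMeasure, integral_withDensity_eq_integral_toReal_smul₀ hw.ennreal_ofReal
    (ae_of_all _ fun _ => ENNReal.ofReal_lt_top)]
  refine integral_congr_ae (hpos.mono fun x hx => ?_)
  simp [ENNReal.toReal_ofReal hx.le]

variable {F : Type*} [NormedAddCommGroup F]

theorem integrable_norm_rpow_iff_memLp {p : ℝ} (hp : 0 < p) {f : α → F}
    (hf : AEStronglyMeasurable f μ) :
    Integrable (fun x => ‖f x‖ ^ p) μ ↔ MemLp f (ENNReal.ofReal p) μ := by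
  have := integrable_norm_rpow_iff hf (p := ENNReal.ofReal p) (by simpa using hp) (by simp)
  rwa [ENNReal.toReal_ofReal hp.le] at this

theorem integral_norm_rpow_eq {p : ℝ} (hp : 0 < p) {f : α → F}
    (hf : MemLp f (ENNReal.ofReal p) μ) :
    ∫ x, ‖f x‖ ^ p ∂μ = (eLpNorm f (ENNReal.ofReal p) μ).toReal ^ p := by
  rw [hf.eLpNorm_eq_integral_rpow_norm (by simpa using hp) (by simp),
    ENNReal.toReal_ofReal hp.le, ENNReal.toReal_ofReal (by positivity),
    ← Real.rpow_mul (integral_nonneg fun x => by positivity), inv_mul_cancel₀ hp.ne', Real.rpow_one]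

/-- Fatou's lemma in the form: an a.e. limit inherits a bound on the integrals. -/
theorem lintegral_le_of_tendsto_ae {f : ℕ → α → ENNReal} {g : α → ENNReal} {b : ℕ → ENNReal}
    {c : ENNReal} (hf : ∀ n, AEMeasurable (f n) μ)
    (hfg : ∀ᵐ x ∂μ, Tendsto (fun n => f n x) atTop (𝓝 (g x)))
    (hle : ∀ᶠ n in atTop, ∫⁻ x, f n x ∂μ ≤ b n) (hb : Tendsto b atTop (𝓝 c)) :
    ∫⁻ x, g x ∂μ ≤ c := by
  calc ∫⁻ x, g x ∂μ = ∫⁻ x, liminf (fun n => f n x) atTop ∂μ :=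
        lintegral_congr_ae (hfg.mono fun x hx => hx.liminf_eq.symm)
    _ ≤ liminf (fun n => ∫⁻ x, f n x ∂μ) atTop := lintegral_liminf_le' hf
    _ ≤ liminf b atTop := liminf_le_liminf hle
    _ = c := hb.liminf_eq

/-- Dominated convergence in `L^p`. -/
theorem tendsto_eLpNorm_zero_of_dominated {p : ℝ} (hp : 0 < p) {f : ℕ → α → F} {g : α → ℝ}
    (hg : MemLp g (ENNReal.ofReal p) μ) (hf : ∀ n, AEStronglyMeasurable (f n) μ)
    (hfg : ∀ n, ∀ᵐ x ∂μ, ‖f n x‖ ≤ g x)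
    (hlim : ∀ᵐ x ∂μ, Tendsto (fun n => f n x) atTop (𝓝 0)) :
    Tendsto (fun n => eLpNorm (f n) (ENNReal.ofReal p) μ) atTop (𝓝 0) := by
  have hp0 : ENNReal.ofReal p ≠ 0 := by simpa using hp
  have h : Tendsto (fun n => ∫⁻ x, ‖f n x‖ₑ ^ p ∂μ) atTop (𝓝 (∫⁻ _, 0 ∂μ)) := by
    refine tendsto_lintegral_of_dominated_convergence' (fun x => ‖g x‖ₑ ^ p)
      (fun n => (hf n).enorm.pow_const p) (fun n => ?_) ?_ ?_
    · filter_upwards [hfg n] with x hx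
      have : ‖f n x‖ₑ ≤ ‖g x‖ₑ := by
        rw [enorm_le_iff_norm_le]
        exact hx.trans (Real.le_norm_self _)
      gcongr
    · have := lintegral_rpow_enorm_lt_top_of_eLpNorm_lt_top hp0 (by simp) hg.2
      rw [ENNReal.toReal_ofReal hp.le] at this
      exact this.ne
    · filter_upwards [hlim] with x hx
      have h0 : Tendsto (fun n => ‖f n x‖ₑ) atTop (𝓝 0) := by simpa using hx.enorm
      simpa [hp] using h0.ennrpow_const p
  rw [lintegral_zero] at h
  have h2 := h.ennrpow_const (1 / p)
  rw [ENNReal.zero_rpow_of_pos (by positivity)] at h2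
  refine h2.congr fun n => ?_
  rw [eLpNorm_eq_lintegral_rpow_enorm_toReal hp0 (by simp), ENNReal.toReal_ofReal hp.le]

end Abstract

/-! ### Gradients of test functions -/

section TestFunction

variable {N : ℕ} {Ω : Set (EuclideanSpace ℝ (Fin N))}

local notation "𝔼" => EuclideanSpace ℝ (Fin N)

theorem gradient_apply_eq_fderiv {φ : 𝔼 → ℝ} (x : 𝔼) (i : Fin N) :
    (∇ φ x) i = fderiv ℝ φ x (EuclideanSpace.single i 1) := by
  have h := inner_gradient_left (𝕜 := ℝ) (f := φ) (x := x) (y := EuclideanSpace.single i 1)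
  rw [← h, EuclideanSpace.inner_single_right]
  simp

theorem continuous_gradient {φ : 𝔼 → ℝ} (h : ContDiff ℝ ∞ φ) : Continuous (∇ φ) :=
  (InnerProductSpace.toDual ℝ 𝔼).symm.continuous.comp (h.continuous_fderiv (by simp))

theorem hasGradientAt_of_contDiff {φ : 𝔼 → ℝ} (h : ContDiff ℝ ∞ φ) (x : 𝔼) :
    HasGradientAt φ (∇ φ x) x :=
  (h.differentiable (by simp) x).hasGradientAt

theorem norm_gradient_eq (φ : 𝔼 → ℝ) (x : 𝔼) : ‖∇ φ x‖ = ‖fderiv ℝ φ x‖ := by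
  rw [gradient]; exact LinearIsometryEquiv.norm_map _ _

theorem HasDerivAt.comp_hasGradientAt {k : ℝ → ℝ} {k' : ℝ} {φ : 𝔼 → ℝ} {g x : 𝔼}
    (hk : HasDerivAt k k' (φ x)) (hφ : HasGradientAt φ g x) :
    HasGradientAt (fun y => k (φ y)) (k' • g) x := by
  rw [hasGradientAt_iff_hasFDerivAt] at hφ ⊢
  refine (hk.comp_hasFDerivAt x hφ).congr_fderiv ?_
  simp

theorem HasGradientAt.mul' {φ ψ : 𝔼 → ℝ} {g h x : 𝔼}
    (hφ : HasGradientAt φ g x) (hψ : HasGradientAt ψ h x) :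
    HasGradientAt (fun y => φ y * ψ y) (ψ x • g + φ x • h) x := by
  rw [hasGradientAt_iff_hasFDerivAt] at *
  refine (hφ.mul hψ).congr_fderiv ?_
  simp [add_comm]

namespace IsTestFunction

variable {φ : EuclideanSpace ℝ (Fin N) → ℝ}

theorem isCompact_tsupport (h : IsTestFunction Ω φ) : IsCompact (tsupport φ) :=
  h.hasCompactSupport

theorem gradient_eq_zero (x : 𝔼) (hx : x ∉ tsupport φ) : ∇ φ x = 0 := by
  have : fderiv ℝ φ x = 0 := by
    by_contra h0
    exact hx (tsupport_fderiv_subset ℝ (subset_tsupport _ h0))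
  simp [gradient, this]

theorem exists_bound (h : IsTestFunction Ω φ) :
    ∃ M, 0 ≤ M ∧ ∀ x, |φ x| ≤ M ∧ ‖∇ φ x‖ ≤ M := by
  obtain ⟨M₁, h₁⟩ := h.hasCompactSupport.exists_bound_of_continuous h.contDiff.continuous
  obtain ⟨M₂, h₂⟩ := (h.hasCompactSupport.fderiv (𝕜 := ℝ)).exists_bound_of_continuous
    (h.contDiff.continuous_fderiv (by simp))
  refine ⟨max M₁ M₂, (abs_nonneg _).trans ((h₁ 0).trans (le_max_left _ _)), fun x =>
    ⟨(h₁ x).trans (le_max_left _ _), ?_⟩⟩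
  rw [norm_gradient_eq]
  exact (h₂ x).trans (le_max_right _ _)

theorem memLp (h : IsTestFunction Ω φ) (q : ENNReal) : MemLp φ q (volume.restrict Ω) :=
  (h.contDiff.continuous.memLp_of_hasCompactSupport h.hasCompactSupport).restrict Ω

/-- Compact support of `φ` in `Ω` removes the boundary term. Limits of this identity along
approximating sequences produce weak gradients. -/
theorem integral_mul_gradient {η : EuclideanSpace ℝ (Fin N) → ℝ} (hφ : IsTestFunction Ω φ)
    (hη : IsTestFunction Ω η) (i : Fin N) :
    ∫ x in Ω, φ x * (∇ η x) i = - ∫ x in Ω, (∇ φ x) i * η x := by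
  have hs : ∀ g : 𝔼 → ℝ, (∀ x, x ∉ tsupport φ → g x = 0) → ∫ x in Ω, g x = ∫ x, g x := by
    intro g hg
    exact setIntegral_eq_integral_of_forall_compl_eq_zero
      fun x hx => hg x fun hx' => hx (hφ.tsupport_subset hx')
  rw [hs _ fun x hx => by rw [image_eq_zero_of_notMem_tsupport hx, zero_mul],
    hs _ fun x hx => by rw [gradient_eq_zero x hx]; simp]
  simp only [gradient_apply_eq_fderiv]
  have hcφ := hφ.contDiff.continuous
  have hcη := hη.contDiff.continuous
  have hc : ∀ {g : 𝔼 → ℝ}, ContDiff ℝ ∞ g →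
      Continuous fun x => fderiv ℝ g x (EuclideanSpace.single i 1) := fun hg =>
    (hg.continuous_fderiv (by simp)).clm_apply continuous_const
  refine integral_mul_fderiv_eq_neg_fderiv_mul_of_integrable ?_ ?_ ?_
    (fun x _ => hφ.contDiff.differentiable (by simp) x)
    (fun x _ => hη.contDiff.differentiable (by simp) x)
  · exact ((hc hφ.contDiff).mul hcη).integrable_of_hasCompactSupport
      (hη.hasCompactSupport.mul_left)
  · exact (hcφ.mul (hc hη.contDiff)).integrable_of_hasCompactSupport
      (hφ.hasCompactSupport.mul_right)
  · exact (hcφ.mul hcη).integrable_of_hasCompactSupport (hφ.hasCompactSupport.mul_right)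

end IsTestFunction

end TestFunction

/-! ### The weighted Sobolev space and its closure of test functions -/

section Weighted

variable {N : ℕ} {Ω : Set (EuclideanSpace ℝ (Fin N))} {p : ℝ}
  {w : EuclideanSpace ℝ (Fin N) → ℝ}

local notation "𝔼" => EuclideanSpace ℝ (Fin N)

namespace IsWeightAp

theorem weightedMeasure_lt_top (hw : IsWeightAp Ω p w) {K : Set 𝔼} (hK : IsCompact K)
    (hKΩ : K ⊆ Ω) : weightedMeasure (volume.restrict Ω) w K < ⊤ := by
  rw [weightedMeasure, withDensity_apply _ hK.measurableSet,
    Measure.restrict_restrict_of_subset hKΩ]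
  exact (hw.locallyIntegrable.integrableOn_compact_subset hKΩ hK).lintegral_lt_top

theorem memLp_indicator (hw : IsWeightAp Ω p w) {K : Set 𝔼} (hK : IsCompact K)
    (hKΩ : K ⊆ Ω) (M : ℝ) (q : ENNReal) :
    MemLp (K.indicator fun _ => M) q (weightedMeasure (volume.restrict Ω) w) :=
  memLp_indicator_const q hK.measurableSet M (Or.inr (hw.weightedMeasure_lt_top hK hKΩ).ne)

theorem memLp_of_bound (hw : IsWeightAp Ω p w) {F : Type*} [NormedAddCommGroup F]
    {K : Set 𝔼} (hK : IsCompact K) (hKΩ : K ⊆ Ω) {g : 𝔼 → F}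
    (hg : AEStronglyMeasurable g (volume.restrict Ω)) {M : ℝ} (hM : ∀ x, ‖g x‖ ≤ M)
    (h0 : ∀ x, x ∉ K → g x = 0) (q : ENNReal) :
    MemLp g q (weightedMeasure (volume.restrict Ω) w) := by
  refine (hw.memLp_indicator hK hKΩ M q).mono
    (hg.mono_ac (weightedMeasure_absolutelyContinuous _ _)) (ae_of_all _ fun x => ?_)
  by_cases hx : x ∈ K
  · rw [Set.indicator_of_mem hx]
    exact (hM x).trans (Real.le_norm_self _)
  · simp [h0 x hx]

theorem memLp_gradient (hw : IsWeightAp Ω p w) {φ : 𝔼 → ℝ} (hφ : IsTestFunction Ω φ)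
    (q : ENNReal) : MemLp (∇ φ) q (weightedMeasure (volume.restrict Ω) w) := by
  obtain ⟨M, -, hM⟩ := hφ.exists_bound
  exact hw.memLp_of_bound hφ.isCompact_tsupport hφ.tsupport_subset
    (continuous_gradient hφ.contDiff).aestronglyMeasurable (fun x => (hM x).2)
    IsTestFunction.gradient_eq_zero q

/-- Local `L¹` bounds from weighted `L^p` bounds. -/
theorem exists_lintegral_enorm_le (hw : IsWeightAp Ω p w) (hp : 1 < p) {K : Set 𝔼}
    (hK : IsCompact K) (hKΩ : K ⊆ Ω) :
    ∃ C : ENNReal, C ≠ ⊤ ∧ ∀ H : 𝔼 → 𝔼,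
      AEStronglyMeasurable H (volume.restrict Ω) →
      ∫⁻ x in K, ‖H x‖ₑ ≤
        C * eLpNorm H (ENNReal.ofReal p) (weightedMeasure (volume.restrict Ω) w) := by
  have hp0 : 0 < p := one_pos.trans hp
  have hq : p.HolderConjugate (Real.conjExponent p) := .conjExponent hp
  set q := Real.conjExponent p with hq_def
  have hres : volume.restrict K ≤ volume.restrict Ω := Measure.restrict_mono hKΩ le_rfl
  have hwK : AEMeasurable w (volume.restrict K) := hw.aemeasurable.mono_measure hres
  have hposK : ∀ᵐ x ∂(volume.restrict K), 0 < w x := ae_mono hres hw.pos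
  set A := ∫⁻ x in K, ENNReal.ofReal (w x ^ (-(1 / (p - 1)))) with hA
  have hAtop : A ≠ ⊤ :=
    (hw.locallyIntegrable_rpow.integrableOn_compact_subset hKΩ hK).lintegral_lt_top.ne
  refine ⟨A ^ (1 / q), ENNReal.rpow_ne_top_of_nonneg (by have := hq.symm.pos; positivity) hAtop,
    fun H hH => ?_⟩
  have hHK : AEStronglyMeasurable H (volume.restrict K) := hH.mono_measure hres
  -- Hölder is applied to `‖H‖ = (w^(1/p) ‖H‖) · w^(-1/p)`. With `q = p/(p-1)`, the second factor to
  -- the power `q` is `w^(-1/(p-1))`, which is integrable on `K` by the `𝒜_p` condition.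
  have e1 : ∫⁻ x in K, ‖H x‖ₑ = ∫⁻ x in K, ((fun x => ENNReal.ofReal (w x ^ (1 / p)) * ‖H x‖ₑ) *
      fun x => ENNReal.ofReal (w x ^ (-(1 / p)))) x := by
    refine lintegral_congr_ae (hposK.mono fun x hx => ?_)
    simp only [Pi.mul_apply]
    rw [mul_right_comm, ← ENNReal.ofReal_mul (by positivity), ← Real.rpow_add hx]
    simp
  have e2 : ∫⁻ x in K, (ENNReal.ofReal (w x ^ (1 / p)) * ‖H x‖ₑ) ^ p ≤
      ∫⁻ x, ‖H x‖ₑ ^ p ∂(weightedMeasure (volume.restrict Ω) w) := by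
    rw [lintegral_weightedMeasure hw.aemeasurable (hH.enorm.pow_const p)]
    refine le_trans (le_of_eq ?_) (lintegral_mono' hres le_rfl)
    refine lintegral_congr_ae (hposK.mono fun x hx => ?_)
    simp only
    rw [ENNReal.mul_rpow_of_nonneg _ _ hp0.le, ENNReal.ofReal_rpow_of_nonneg (by positivity) hp0.le,
      ← Real.rpow_mul hx.le, one_div_mul_cancel hp0.ne', Real.rpow_one]
  have e3 : ∫⁻ x in K, ENNReal.ofReal (w x ^ (-(1 / p))) ^ q = A := by
    refine lintegral_congr_ae (hposK.mono fun x hx => ?_)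
    simp only
    rw [ENNReal.ofReal_rpow_of_nonneg (by positivity) hq.symm.nonneg, ← Real.rpow_mul hx.le]
    congr 2
    rw [hq_def, Real.conjExponent]
    have : p - 1 ≠ 0 := by linarith
    field_simp
  rw [e1]
  refine (ENNReal.lintegral_mul_le_Lp_mul_Lq _ hq
    ((hwK.pow_const _).ennreal_ofReal.mul hHK.enorm) (hwK.pow_const _).ennreal_ofReal).trans ?_
  rw [e3, mul_comm, eLpNorm_eq_lintegral_rpow_enorm_toReal (by simpa using hp0) (by simp),
    ENNReal.toReal_ofReal hp0.le]
  exact mul_le_mul_right (ENNReal.rpow_le_rpow e2 (by positivity)) _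

end IsWeightAp

theorem HasWeakGradient.aestronglyMeasurable {u : 𝔼 → ℝ} {G : 𝔼 → 𝔼}
    (h : HasWeakGradient Ω u G) : AEStronglyMeasurable u (volume.restrict Ω) :=
  h.locallyIntegrable.aestronglyMeasurable

theorem HasWeakGradient.aestronglyMeasurable_grad {u : 𝔼 → ℝ} {G : 𝔼 → 𝔼}
    (h : HasWeakGradient Ω u G) : AEStronglyMeasurable G (volume.restrict Ω) :=
  h.locallyIntegrable_grad.aestronglyMeasurable

theorem IsWeightAp.integrable_norm_rpow_iff_memLp (hw : IsWeightAp Ω p w) (hp : 0 < p) {H : 𝔼 → 𝔼}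
    (hH : AEStronglyMeasurable H (volume.restrict Ω)) :
    IntegrableOn (fun x => w x * ‖H x‖ ^ p) Ω volume ↔
      MemLp H (ENNReal.ofReal p) (weightedMeasure (volume.restrict Ω) w) := by
  rw [← _root_.integrable_norm_rpow_iff_memLp hp
    (hH.mono_ac (weightedMeasure_absolutelyContinuous _ _)),
    integrable_weightedMeasure_iff hw.aemeasurable hw.pos, IntegrableOn]

theorem MemWeightedSobolev.memLp (hp : 0 < p) {u : 𝔼 → ℝ} {G : 𝔼 → 𝔼}
    (h : MemWeightedSobolev Ω p w u G) : MemLp u (ENNReal.ofReal p) (volume.restrict Ω) :=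
  (integrable_norm_rpow_iff_memLp hp h.hasWeakGradient.aestronglyMeasurable).1 h.integrable

theorem MemWeightedSobolev.memLp_grad (hw : IsWeightAp Ω p w) (hp : 0 < p)
    {u : 𝔼 → ℝ} {G : 𝔼 → 𝔼} (h : MemWeightedSobolev Ω p w u G) :
    MemLp G (ENNReal.ofReal p) (weightedMeasure (volume.restrict Ω) w) :=
  (hw.integrable_norm_rpow_iff_memLp hp
    h.hasWeakGradient.aestronglyMeasurable_grad).1 h.integrable_grad

theorem weightedSobolevNorm_eq (hw : IsWeightAp Ω p w) (hp : 0 < p) {u : 𝔼 → ℝ} {G : 𝔼 → 𝔼}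
    (hu : MemLp u (ENNReal.ofReal p) (volume.restrict Ω))
    (hG : MemLp G (ENNReal.ofReal p) (weightedMeasure (volume.restrict Ω) w)) :
    weightedSobolevNorm Ω p w u G =
      ((eLpNorm u (ENNReal.ofReal p) (volume.restrict Ω)).toReal ^ p +
        (eLpNorm G (ENNReal.ofReal p) (weightedMeasure (volume.restrict Ω) w)).toReal ^ p)
          ^ (1 / p) := by
  rw [weightedSobolevNorm, ← integral_norm_rpow_eq hp hu, ← integral_norm_rpow_eq hp hG,
    integral_weightedMeasure hw.aemeasurable hw.pos]
  rfl

theorem exists_subseq_tendsto_ae {α F : Type*} [MeasurableSpace α] {μ : Measure α}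
    [NormedAddCommGroup F] {q : ENNReal} (hq : q ≠ 0) {f : ℕ → α → F} {g : α → F}
    (hf : ∀ n, AEStronglyMeasurable (f n) μ) (hg : AEStronglyMeasurable g μ)
    (h : Tendsto (fun n => eLpNorm (fun x => g x - f n x) q μ) atTop (𝓝 0)) :
    ∃ ns : ℕ → ℕ, StrictMono ns ∧ ∀ᵐ x ∂μ, Tendsto (fun n => f (ns n) x) atTop (𝓝 (g x)) := by
  refine (tendstoInMeasure_of_tendsto_eLpNorm hq hf hg (h.congr fun n => ?_)).exists_seq_tendsto_ae
  rw [← eLpNorm_neg]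
  congr 1
  ext x
  simp

/-- An approximating sequence of test functions, converging also almost everywhere. -/
theorem MemWeightedSobolevZero.exists_seq (hw : IsWeightAp Ω p w) (hp : 0 < p)
    {u : 𝔼 → ℝ} {G : 𝔼 → 𝔼} (h : MemWeightedSobolevZero Ω p w u G) :
    ∃ φ : ℕ → 𝔼 → ℝ, (∀ n, IsTestFunction Ω (φ n)) ∧
      Tendsto (fun n => eLpNorm (fun x => G x - ∇ (φ n) x) (ENNReal.ofReal p)
        (weightedMeasure (volume.restrict Ω) w)) atTop (𝓝 0) ∧
      ∀ᵐ x ∂(volume.restrict Ω), Tendsto (fun n => φ n x) atTop (𝓝 (u x)) := by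
  obtain ⟨φ, hφ, hlim⟩ := h.exists_approx
  have hu := h.memWeightedSobolev.memLp hp
  have hG := h.memWeightedSobolev.memLp_grad hw hp
  have hu' := fun n => hu.sub ((hφ n).memLp (ENNReal.ofReal p))
  have hG' := fun n => hG.sub (hw.memLp_gradient (hφ n) (ENNReal.ofReal p))
  -- The Sobolev norm dominates each of its two summands; this passes from its convergence to that
  -- of either `L^p` norm.
  have hsq : ∀ {a : ℕ → ENNReal}, (∀ n, a n ≠ ⊤) →
      (∀ n, (a n).toReal ^ p ≤ (eLpNorm (u - φ n) (ENNReal.ofReal p) (volume.restrict Ω)).toReal ^ p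
        + (eLpNorm (G - ∇ (φ n)) (ENNReal.ofReal p)
          (weightedMeasure (volume.restrict Ω) w)).toReal ^ p) →
      Tendsto a atTop (𝓝 0) := by
    intro a ha hle
    have : Tendsto (fun n => (a n).toReal) atTop (𝓝 0) := by
      refine squeeze_zero (fun _ => ENNReal.toReal_nonneg) (fun n => ?_) hlim
      have := weightedSobolevNorm_eq hw hp (hu' n) (hG' n)
      simp only [Pi.sub_def] at this hle
      rw [this]
      refine le_trans (le_of_eq ?_) (Real.rpow_le_rpow (by positivity) (hle n) (by positivity))
      rw [← Real.rpow_mul ENNReal.toReal_nonneg, mul_one_div_cancel hp.ne', Real.rpow_one]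
    exact (ENNReal.tendsto_toReal_iff ha ENNReal.zero_ne_top).1 (by simpa using this)
  have h1 := hsq (fun n => (hu' n).2.ne) fun n => le_add_of_nonneg_right (by positivity)
  have h2 := hsq (fun n => (hG' n).2.ne) fun n => le_add_of_nonneg_left (by positivity)
  obtain ⟨ns, hns, hae⟩ := exists_subseq_tendsto_ae (by simpa using hp)
    (fun n => ((hφ n).memLp (ENNReal.ofReal p)).1) hu.1 h1
  exact ⟨fun n => φ (ns n), fun n => hφ _, h2.comp hns.tendsto_atTop, hae⟩

/-- Limits of test functions in `W^{1,p}(Ω, w)` are in `W_0^{1,p}(Ω, w)`. -/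
theorem memWeightedSobolevZero_of_tendsto (hw : IsWeightAp Ω p w) (hp : 1 < p) (hΩ : IsOpen Ω)
    (hΩ' : Bornology.IsBounded Ω) {u : 𝔼 → ℝ} {G : 𝔼 → 𝔼} {φ : ℕ → 𝔼 → ℝ}
    (hu : MemLp u (ENNReal.ofReal p) (volume.restrict Ω))
    (hG : MemLp G (ENNReal.ofReal p) (weightedMeasure (volume.restrict Ω) w))
    (hφ : ∀ n, IsTestFunction Ω (φ n))
    (hlim : Tendsto (fun n => eLpNorm (fun x => u x - φ n x) (ENNReal.ofReal p)
      (volume.restrict Ω)) atTop (𝓝 0))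
    (hlim' : Tendsto (fun n => eLpNorm (fun x => G x - ∇ (φ n) x) (ENNReal.ofReal p)
      (weightedMeasure (volume.restrict Ω) w)) atTop (𝓝 0)) :
    MemWeightedSobolevZero Ω p w u G := by
  have hp0 : 0 < p := one_pos.trans hp
  have : IsFiniteMeasure (volume.restrict Ω) := ⟨by simpa using hΩ'.measure_lt_top⟩
  have hGm : AEStronglyMeasurable G (volume.restrict Ω) :=
    hG.1.mono_ac (absolutelyContinuous_weightedMeasure hw.aemeasurable hw.pos)
  have hφm : ∀ n, AEStronglyMeasurable (∇ (φ n)) (volume.restrict Ω) := fun n =>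
    (continuous_gradient (hφ n).contDiff).aestronglyMeasurable
  have huint : IntegrableOn u Ω :=
    memLp_one_iff_integrable.1 (hu.mono_exponent (by simpa using hp.le))
  have hGint : ∀ K ⊆ Ω, IsCompact K → IntegrableOn G K := fun K hKΩ hK => by
    obtain ⟨C, hC, hCle⟩ := hw.exists_lintegral_enorm_le hp hK hKΩ
    exact ⟨hGm.mono_measure (Measure.restrict_mono hKΩ le_rfl),
      (hCle G hGm).trans_lt (ENNReal.mul_lt_top hC.lt_top hG.2)⟩
  refine ⟨⟨⟨huint.locallyIntegrableOn, (locallyIntegrableOn_iff hΩ.isLocallyClosed).2 hGint,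
    fun η hη i => ?_⟩, (integrable_norm_rpow_iff_memLp hp0 hu.1).2 hu,
    (hw.integrable_norm_rpow_iff_memLp hp0 hGm).2 hG⟩, φ, hφ, ?_⟩
  · obtain ⟨M, hM0, hM⟩ := hη.exists_bound
    have hcoord : ∀ (v : 𝔼), |v i| ≤ ‖v‖ := fun v => PiLp.norm_apply_le v i
    have hηc : Continuous fun x => (∇ η x) i :=
      (EuclideanSpace.proj i).continuous.comp (continuous_gradient hη.contDiff)
    have t1 : Tendsto (fun n => ∫ x in Ω, φ n x * (∇ η x) i) atTop
        (𝓝 (∫ x in Ω, u x * (∇ η x) i)) := by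
      refine tendsto_integral_of_L1 _ (hu.1.mul hηc.aestronglyMeasurable)
        (Eventually.of_forall fun n => ?_) ?_
      · exact (((hφ n).contDiff.continuous.mul hηc).integrable_of_hasCompactSupport
          (hφ n).hasCompactSupport.mul_right).integrableOn
      -- `Ω` has finite measure, so `L^p` convergence implies `L¹` convergence, and `∇ η` is
      -- bounded.
      · have key : ∀ n, ∫⁻ x in Ω, ‖φ n x * (∇ η x) i - u x * (∇ η x) i‖ₑ ≤
            ENNReal.ofReal M * (eLpNorm (fun x => u x - φ n x) (ENNReal.ofReal p)
              (volume.restrict Ω) * volume.restrict Ω Set.univ ^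
                (1 / (1 : ENNReal).toReal - 1 / (ENNReal.ofReal p).toReal)) := by
          intro n
          refine le_trans ?_ (mul_le_mul_right (eLpNorm_le_eLpNorm_mul_rpow_measure_univ
            (p := 1) (by simpa using hp.le) (hu.1.sub ((hφ n).memLp 1).1)) _)
          rw [eLpNorm_one_eq_lintegral_enorm, ← lintegral_const_mul' _ _ (by simp)]
          refine lintegral_mono fun x => ?_
          rw [← sub_mul, enorm_mul, mul_comm]
          gcongr
          · rw [Real.enorm_eq_ofReal_abs]
            exact ENNReal.ofReal_le_ofReal ((hcoord _).trans (hM x).2)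
          · rw [← enorm_neg]; simp
        refine tendsto_of_tendsto_of_tendsto_of_le_of_le tendsto_const_nhds ?_
          (fun _ => zero_le) key
        have := ENNReal.Tendsto.const_mul (a := ENNReal.ofReal M)
          (ENNReal.Tendsto.mul_const (b := volume.restrict Ω Set.univ ^
            (1 / (1 : ENNReal).toReal - 1 / (ENNReal.ofReal p).toReal)) hlim (Or.inr ?_))
          (Or.inr ENNReal.ofReal_ne_top)
        · simpa using this
        · refine ENNReal.rpow_ne_top_of_nonneg ?_ (measure_ne_top _ _)
          rw [ENNReal.toReal_ofReal hp0.le]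
          simp [inv_le_one_of_one_le₀ hp.le]
    have t2 : Tendsto (fun n => ∫ x in Ω, (∇ (φ n) x) i * η x) atTop
        (𝓝 (∫ x in Ω, (G x) i * η x)) := by
      have hGi : AEStronglyMeasurable (fun x => (G x) i) (volume.restrict Ω) :=
        (EuclideanSpace.proj i).continuous.comp_aestronglyMeasurable hGm
      refine tendsto_integral_of_L1 _ (hGi.mul hη.contDiff.continuous.aestronglyMeasurable)
        (Eventually.of_forall fun n => ?_) ?_
      · have hc : Continuous fun x => (∇ (φ n) x) i :=
          (EuclideanSpace.proj i).continuous.comp (continuous_gradient (hφ n).contDiff)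
        exact ((hc.mul hη.contDiff.continuous).integrable_of_hasCompactSupport
          hη.hasCompactSupport.mul_left).integrableOn
      -- Only the compact support of `η` matters, and there the weighted `L^p` norm controls the
      -- `L¹` norm.
      · obtain ⟨C, hC, hCle⟩ :=
          hw.exists_lintegral_enorm_le hp hη.isCompact_tsupport hη.tsupport_subset
        have key : ∀ n, ∫⁻ x in Ω, ‖(∇ (φ n) x) i * η x - (G x) i * η x‖ₑ ≤
            ENNReal.ofReal M * (C * eLpNorm (fun x => G x - ∇ (φ n) x) (ENNReal.ofReal p)
              (weightedMeasure (volume.restrict Ω) w)) := by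
          intro n
          refine le_trans ?_ (mul_le_mul_right (hCle _ (hGm.sub (hφm n))) _)
          rw [← lintegral_const_mul' _ _ (by simp),
            ← Measure.restrict_restrict_of_subset hη.tsupport_subset,
            ← lintegral_indicator hη.isCompact_tsupport.measurableSet]
          refine lintegral_mono fun x => ?_
          by_cases hx : x ∈ tsupport η
          · rw [Set.indicator_of_mem hx, ← sub_mul, enorm_mul, mul_comm]
            gcongr
            · rw [Real.enorm_eq_ofReal_abs]
              exact ENNReal.ofReal_le_ofReal (hM x).1
            · rw [enorm_le_iff_norm_le, Pi.sub_apply, norm_sub_rev (G x), ← PiLp.sub_apply]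
              exact hcoord _
          · simp [image_eq_zero_of_notMem_tsupport hx]
        refine tendsto_of_tendsto_of_tendsto_of_le_of_le tendsto_const_nhds ?_
          (fun _ => zero_le) key
        have := ENNReal.Tendsto.const_mul (a := ENNReal.ofReal M)
          (ENNReal.Tendsto.const_mul (a := C) hlim' (Or.inr hC))
          (Or.inr ENNReal.ofReal_ne_top)
        simpa using this
    refine tendsto_nhds_unique t1 ?_
    refine t2.neg.congr fun n => ?_
    rw [(hφ n).integral_mul_gradient hη i]
  · have hu' := fun n => hu.sub ((hφ n).memLp (ENNReal.ofReal p))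
    have hG' := fun n => hG.sub (hw.memLp_gradient (hφ n) (ENNReal.ofReal p))
    have a1 := ((ENNReal.tendsto_toReal_iff (fun n => (hu' n).2.ne) ENNReal.zero_ne_top).2
      hlim).rpow_const (p := p) (Or.inr hp0.le)
    have a2 := ((ENNReal.tendsto_toReal_iff (fun n => (hG' n).2.ne) ENNReal.zero_ne_top).2
      hlim').rpow_const (p := p) (Or.inr hp0.le)
    have a3 := (a1.add a2).rpow_const (p := 1 / p) (Or.inr (by positivity))
    have h0 : ((0 : ENNReal).toReal ^ p + (0 : ENNReal).toReal ^ p) ^ (1 / p) = 0 := by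
      simp [Real.zero_rpow hp0.ne', Real.zero_rpow (inv_ne_zero hp0.ne')]
    rw [h0] at a3
    refine a3.congr fun n => ?_
    exact (weightedSobolevNorm_eq hw hp0 (hu' n) (hG' n)).symm

end Weighted

/-! ### Stability of `W_0^{1,p}(Ω, w)` under `v ↦ θ h(v)` -/

section Composition

variable {N : ℕ} {Ω : Set (EuclideanSpace ℝ (Fin N))} {p : ℝ}
  {w : EuclideanSpace ℝ (Fin N) → ℝ}

local notation "𝔼" => EuclideanSpace ℝ (Fin N)

theorem gradient_comp {k : ℝ → ℝ} {φ : 𝔼 → ℝ} (hk : ContDiff ℝ ∞ k) (hφ : ContDiff ℝ ∞ φ)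
    (x : 𝔼) : ∇ (fun y => k (φ y)) x = deriv k (φ x) • ∇ φ x :=
  ((hk.differentiable (by simp) _).hasDerivAt.comp_hasGradientAt
    (hasGradientAt_of_contDiff hφ x)).gradient

theorem IsTestFunction.mul_comp {θ φ : 𝔼 → ℝ} {h : ℝ → ℝ} (hθ : IsTestFunction Ω θ)
    (hφ : ContDiff ℝ ∞ φ) (hh : ContDiff ℝ ∞ h) :
    IsTestFunction Ω fun x => θ x * h (φ x) :=
  ⟨hθ.contDiff.mul (hh.comp hφ), hθ.hasCompactSupport.mul_right,
    (tsupport_mul_subset_left).trans hθ.tsupport_subset⟩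

/-- If `v ∈ W_0^{1,p}(Ω, w)`, then so is `θ h(v)`, for a test function `θ` and a smooth bounded
`h` with bounded derivative. -/
theorem MemWeightedSobolevZero.mul_comp (hw : IsWeightAp Ω p w) (hp : 1 < p) (hΩ : IsOpen Ω)
    (hΩ' : Bornology.IsBounded Ω) {v : 𝔼 → ℝ} {G : 𝔼 → 𝔼}
    (hv : MemWeightedSobolevZero Ω p w v G) {θ : 𝔼 → ℝ} (hθ : IsTestFunction Ω θ) {h : ℝ → ℝ}
    (hh : ContDiff ℝ ∞ h) {M : ℝ} (hM : ∀ t, |h t| ≤ M ∧ |deriv h t| ≤ M) :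
    MemWeightedSobolevZero Ω p w (fun x => θ x * h (v x))
      fun x => h (v x) • ∇ θ x + (θ x * deriv h (v x)) • G x := by
  have hp0 : 0 < p := one_pos.trans hp
  have : IsFiniteMeasure (volume.restrict Ω) := ⟨by simpa using hΩ'.measure_lt_top⟩
  set ν := weightedMeasure (volume.restrict Ω) w with hν
  have hac : ν ≪ volume.restrict Ω := weightedMeasure_absolutelyContinuous _ _
  obtain ⟨φ, hφ, hlim, hae⟩ := hv.exists_seq hw hp0
  obtain ⟨M', hM'0, hM'⟩ := hθ.exists_bound
  have hM0 : 0 ≤ M := (abs_nonneg _).trans (hM 0).1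
  have hvm := hv.memWeightedSobolev.hasWeakGradient.aestronglyMeasurable
  have hGm := hv.memWeightedSobolev.hasWeakGradient.aestronglyMeasurable_grad
  have hGp := hv.memWeightedSobolev.memLp_grad hw hp0
  have hθc := hθ.contDiff.continuous
  have hhc := hh.continuous
  have hhc' : Continuous (deriv h) := hh.continuous_deriv (by simp)
  have hθg := continuous_gradient hθ.contDiff
  have hφc := fun n => (hφ n).contDiff.continuous
  have hφg := fun n => continuous_gradient (hφ n).contDiff
  have hhv := hhc.comp_aestronglyMeasurable hvm
  have hhv' := hhc'.comp_aestronglyMeasurable hvm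
  have hhφ := fun n => (hhc.comp (hφc n)).aestronglyMeasurable (μ := volume.restrict Ω)
  have hhφ' := fun n => (hhc'.comp (hφc n)).aestronglyMeasurable (μ := volume.restrict Ω)
  have hprod : ∀ x t, |θ x * h t| ≤ M' * M := fun x t => by
    rw [abs_mul]; exact mul_le_mul (hM' x).1 (hM t).1 (abs_nonneg _) hM'0
  have hprod' : ∀ x t, |θ x * deriv h t| ≤ M' * M := fun x t => by
    rw [abs_mul]; exact mul_le_mul (hM' x).1 (hM t).2 (abs_nonneg _) hM'0
  refine memWeightedSobolevZero_of_tendsto hw hp hΩ hΩ' ?_ ?_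
    (fun n => hθ.mul_comp (hφ n).contDiff hh) ?_ ?_
  · exact MemLp.of_bound (hθc.aestronglyMeasurable.mul hhv) (M' * M)
      (ae_of_all _ fun x => hprod x _)
  · refine MemLp.add ?_ ?_
    · refine hw.memLp_of_bound (M := M * M') hθ.isCompact_tsupport hθ.tsupport_subset
        (hhv.smul hθg.aestronglyMeasurable) (fun x => ?_) (fun x hx => ?_) _
      · rw [Pi.smul_apply', norm_smul]
        exact mul_le_mul (hM _).1 (hM' x).2 (norm_nonneg _) hM0
      · rw [Pi.smul_apply', IsTestFunction.gradient_eq_zero x hx, smul_zero]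
    · refine hGp.of_le_mul (c := M' * M)
        (((hθc.aestronglyMeasurable.mul hhv').smul hGm).mono_ac hac) (ae_of_all _ fun x => ?_)
      rw [norm_smul]
      exact mul_le_mul_of_nonneg_right (hprod' x _) (norm_nonneg _)
  · refine tendsto_eLpNorm_zero_of_dominated hp0 (g := fun _ => M' * M + M' * M) (memLp_const _)
      (fun n => (hθc.aestronglyMeasurable.mul hhv).sub (hθc.aestronglyMeasurable.mul (hhφ n)))
      (fun n => ae_of_all _ fun x => ?_) ?_
    · exact (norm_sub_le _ _).trans (add_le_add (hprod x _) (hprod x _))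
    · filter_upwards [hae] with x hx
      have := (tendsto_const_nhds (x := θ x * h (v x))).sub
        (((hhc.tendsto _).comp hx).const_mul (θ x))
      simpa using this
  -- The first two terms of this splitting tend to zero by dominated convergence, using only `φ n →
  -- v` a.e. and the bounds on `h` and `h'`. The third has a bounded coefficient times `G - ∇ (φ
  -- n)`, which tends to zero in norm.
  · have e : ∀ n, (fun x => h (v x) • ∇ θ x + (θ x * deriv h (v x)) • G x
        - ∇ (fun x => θ x * h (φ n x)) x) =
        ((fun x => (h (v x) - h (φ n x)) • ∇ θ x) +
          fun x => (θ x * (deriv h (v x) - deriv h (φ n x))) • G x) +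
          fun x => (θ x * deriv h (φ n x)) • (G x - ∇ (φ n) x) := by
      intro n
      ext1 x
      have hg := (hasGradientAt_of_contDiff hθ.contDiff x).mul'
        ((hh.differentiable (by simp) _).hasDerivAt.comp_hasGradientAt
          (hasGradientAt_of_contDiff (hφ n).contDiff x))
      rw [hg.gradient]
      simp only [Pi.add_apply]
      module
    have m1 : ∀ n, AEStronglyMeasurable (fun x => (h (v x) - h (φ n x)) • ∇ θ x) ν := fun n =>
      ((hhv.sub (hhφ n)).smul hθg.aestronglyMeasurable).mono_ac hac
    have m2 : ∀ n, AEStronglyMeasurable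
        (fun x => (θ x * (deriv h (v x) - deriv h (φ n x))) • G x) ν := fun n =>
      ((hθc.aestronglyMeasurable.mul (hhv'.sub (hhφ' n))).smul hGm).mono_ac hac
    have m3 : ∀ n, AEStronglyMeasurable
        (fun x => (θ x * deriv h (φ n x)) • (G x - ∇ (φ n) x)) ν := fun n =>
      ((hθc.aestronglyMeasurable.mul (hhφ' n)).smul
        (hGm.sub (hφg n).aestronglyMeasurable)).mono_ac hac
    have t1 : Tendsto (fun n => eLpNorm (fun x => (h (v x) - h (φ n x)) • ∇ θ x)
        (ENNReal.ofReal p) ν) atTop (𝓝 0) := by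
      refine tendsto_eLpNorm_zero_of_dominated hp0
        (hw.memLp_indicator hθ.isCompact_tsupport hθ.tsupport_subset ((M + M) * M') _) m1
        (fun n => ae_of_all _ fun x => ?_) ?_
      · by_cases hx : x ∈ tsupport θ
        · rw [Set.indicator_of_mem hx, norm_smul]
          exact mul_le_mul ((norm_sub_le _ _).trans (add_le_add (hM _).1 (hM _).1)) (hM' x).2
            (norm_nonneg _) (by positivity)
        · simp [IsTestFunction.gradient_eq_zero x hx, Set.indicator_of_notMem hx]
      · filter_upwards [hac.ae_le hae] with x hx
        have := ((tendsto_const_nhds (x := h (v x))).sub ((hhc.tendsto _).comp hx)).smul_const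
          (∇ θ x)
        simpa using this
    have t2 : Tendsto (fun n => eLpNorm
        (fun x => (θ x * (deriv h (v x) - deriv h (φ n x))) • G x)
        (ENNReal.ofReal p) ν) atTop (𝓝 0) := by
      refine tendsto_eLpNorm_zero_of_dominated hp0 (hGp.norm.const_mul (M' * (M + M))) m2
        (fun n => ae_of_all _ fun x => ?_) ?_
      · rw [norm_smul]
        refine mul_le_mul_of_nonneg_right ?_ (norm_nonneg _)
        rw [norm_mul]
        exact mul_le_mul (hM' x).1 ((norm_sub_le _ _).trans (add_le_add (hM _).2 (hM _).2))
            (norm_nonneg _) hM'0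
      · filter_upwards [hac.ae_le hae] with x hx
        have := (((tendsto_const_nhds (x := deriv h (v x))).sub
          ((hhc'.tendsto _).comp hx)).const_mul (θ x)).smul_const (G x)
        simpa using this
    have t3 : Tendsto (fun n => eLpNorm
        (fun x => (θ x * deriv h (φ n x)) • (G x - ∇ (φ n) x))
        (ENNReal.ofReal p) ν) atTop (𝓝 0) := by
      have := ENNReal.Tendsto.const_mul (a := ENNReal.ofReal (M' * M)) hlim
        (Or.inr ENNReal.ofReal_ne_top)
      rw [mul_zero] at this
      refine tendsto_of_tendsto_of_tendsto_of_le_of_le tendsto_const_nhds this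
          (fun _ => zero_le) fun n => ?_
      refine eLpNorm_le_mul_eLpNorm_of_ae_le_mul (ae_of_all _ fun x => ?_) _
      rw [norm_smul]
      exact mul_le_mul_of_nonneg_right (hprod' x _) (norm_nonneg _)
    have t := (t1.add t2).add t3
    simp only [add_zero] at t
    refine tendsto_of_tendsto_of_tendsto_of_le_of_le tendsto_const_nhds t
          (fun _ => zero_le) fun n => ?_
    have hp1 : 1 ≤ ENNReal.ofReal p := by simpa using hp.le
    simp only [e n]
    exact (eLpNorm_add_le ((m1 n).add (m2 n)) (m3 n) hp1).trans
      (add_le_add_left (eLpNorm_add_le (m1 n) (m2 n) hp1) _)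

end Composition

/-! ### A Poincaré inequality on balls -/

section Poincare

variable {N : ℕ}

local notation "𝔼" => EuclideanSpace ℝ (Fin N)

/-- Fundamental theorem of calculus along the segment from `x` to `x + h`. -/
theorem enorm_sub_le_lintegral_gradient {F : 𝔼 → ℝ} (hF : ContDiff ℝ ∞ F) (x h : 𝔼) :
    ‖F (x + h) - F x‖ₑ ≤ ‖h‖ₑ * ∫⁻ t in Set.Ioc (0 : ℝ) 1, ‖∇ F (x + t • h)‖ₑ := by
  have hd : ∀ t : ℝ, HasDerivAt (fun t : ℝ => F (x + t • h)) (fderiv ℝ F (x + t • h) h) t := by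
    intro t
    have h1 : HasDerivAt (fun t : ℝ => x + t • h) h t := by
      simpa using ((hasDerivAt_id t).smul_const h).const_add x
    exact (hF.differentiable (by simp) _).hasFDerivAt.comp_hasDerivAt t h1
  have hc : Continuous fun t : ℝ => fderiv ℝ F (x + t • h) h :=
    ((hF.continuous_fderiv (by simp)).comp (by fun_prop)).clm_apply continuous_const
  have := intervalIntegral.integral_eq_sub_of_hasDerivAt (fun t _ => hd t)
    (hc.intervalIntegrable 0 1)
  simp only [one_smul, zero_smul, add_zero] at this
  rw [← this, intervalIntegral.integral_of_le zero_le_one, ← lintegral_const_mul' _ _ (by simp)]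
  refine (enorm_integral_le_lintegral_enorm _).trans (lintegral_mono fun t => ?_)
  rw [← inner_gradient_left (𝕜 := ℝ), ← ofReal_norm, ← ofReal_norm h, ← ofReal_norm (∇ F _),
    ← ENNReal.ofReal_mul (norm_nonneg _), mul_comm]
  exact ENNReal.ofReal_le_ofReal (norm_inner_le_norm _ _)

/-- A Poincaré inequality on balls for smooth functions. -/
theorem lintegral_enorm_sub_le_lintegral_gradient {F : 𝔼 → ℝ} (hF : ContDiff ℝ ∞ F) (z : 𝔼)
    {R : ℝ} :
    ∫⁻ x in Metric.ball z R, ∫⁻ y in Metric.ball z R, ‖F y - F x‖ₑ ≤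
      ENNReal.ofReal (2 * R) * volume (Metric.ball (0 : 𝔼) (2 * R)) *
        ∫⁻ x in Metric.closedBall z (3 * R), ‖∇ F x‖ₑ := by
  have hFc := hF.continuous
  have hFg := continuous_gradient hF
  set J := ∫⁻ x in Metric.closedBall z (3 * R), ‖∇ F x‖ₑ with hJ
  -- Translation by `t • h` with `‖h‖ < 2R` and `t ≤ 1` moves the ball of radius `R` inside the one
  -- of radius `3R`; this is the origin of the factor 3.
  have hshift : ∀ h ∈ Metric.ball (0 : 𝔼) (2 * R), ∀ t ∈ Set.Ioc (0 : ℝ) 1,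
      ∫⁻ x in Metric.ball z R, ‖∇ F (x + t • h)‖ₑ ≤ J := by
    intro h hh t ht
    rw [hJ, ← lintegral_indicator measurableSet_closedBall, ← lintegral_indicator measurableSet_ball,
      ← lintegral_add_right_eq_self ((Metric.closedBall z (3 * R)).indicator _) (t • h)]
    refine lintegral_mono fun x => ?_
    by_cases hx : x ∈ Metric.ball z R
    · have : x + t • h ∈ Metric.closedBall z (3 * R) := by
        rw [mem_closedBall_iff_norm]
        rw [mem_ball_iff_norm] at hx
        rw [mem_ball_zero_iff] at hh
        have h1 : ‖t • h‖ ≤ ‖h‖ := by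
          rw [norm_smul, Real.norm_of_nonneg ht.1.le]
          exact mul_le_of_le_one_left (norm_nonneg _) ht.2
        calc ‖x + t • h - z‖ = ‖(x - z) + t • h‖ := by congr 1; abel
          _ ≤ ‖x - z‖ + ‖t • h‖ := norm_add_le _ _
          _ ≤ 3 * R := by linarith
      rw [Set.indicator_of_mem hx, Set.indicator_of_mem this]
    · simp [Set.indicator_of_notMem hx]
  have hdiff : ∀ h ∈ Metric.ball (0 : 𝔼) (2 * R),
      ∫⁻ x in Metric.ball z R, ‖F (x + h) - F x‖ₑ ≤ ENNReal.ofReal (2 * R) * J := by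
    intro h hh
    calc ∫⁻ x in Metric.ball z R, ‖F (x + h) - F x‖ₑ
        ≤ ∫⁻ x in Metric.ball z R, ‖h‖ₑ * ∫⁻ t in Set.Ioc (0 : ℝ) 1, ‖∇ F (x + t • h)‖ₑ :=
          lintegral_mono fun x => enorm_sub_le_lintegral_gradient hF x h
      _ = ‖h‖ₑ * ∫⁻ t in Set.Ioc (0 : ℝ) 1, ∫⁻ x in Metric.ball z R, ‖∇ F (x + t • h)‖ₑ := by
          rw [lintegral_const_mul' _ _ (by simp), lintegral_lintegral_swap]
          exact Continuous.aemeasurable (by fun_prop)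
      _ ≤ ‖h‖ₑ * ∫⁻ t in Set.Ioc (0 : ℝ) 1, J :=
          mul_le_mul_right (setLIntegral_mono' measurableSet_Ioc (hshift h hh)) _
      _ ≤ ENNReal.ofReal (2 * R) * J := by
          rw [setLIntegral_const]
          simp only [Real.volume_Ioc, sub_zero, ENNReal.ofReal_one, mul_one]
          gcongr
          rw [← ofReal_norm]
          exact ENNReal.ofReal_le_ofReal (mem_ball_zero_iff.1 hh).le
  calc ∫⁻ x in Metric.ball z R, ∫⁻ y in Metric.ball z R, ‖F y - F x‖ₑ
      ≤ ∫⁻ x in Metric.ball z R, ∫⁻ h in Metric.ball (0 : 𝔼) (2 * R), ‖F (x + h) - F x‖ₑ := by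
        -- Substitute `y = x + h`: two points of the ball differ by less than `2R`.
        refine setLIntegral_mono' measurableSet_ball fun x hx => ?_
        rw [← lintegral_indicator measurableSet_ball, ← lintegral_add_left_eq_self _ x,
          ← lintegral_indicator measurableSet_ball]
        refine lintegral_mono fun h => ?_
        by_cases hh : x + h ∈ Metric.ball z R
        · have : h ∈ Metric.ball (0 : 𝔼) (2 * R) := by
            rw [mem_ball_iff_norm] at hx hh
            rw [mem_ball_zero_iff]
            calc ‖h‖ = ‖(x + h - z) - (x - z)‖ := by congr 1; abel
              _ ≤ ‖x + h - z‖ + ‖x - z‖ := norm_sub_le _ _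
              _ < 2 * R := by linarith
          rw [Set.indicator_of_mem hh, Set.indicator_of_mem this]
        · simp [Set.indicator_of_notMem hh]
    _ = ∫⁻ h in Metric.ball (0 : 𝔼) (2 * R), ∫⁻ x in Metric.ball z R, ‖F (x + h) - F x‖ₑ := by
        rw [lintegral_lintegral_swap]
        exact Continuous.aemeasurable (by fun_prop)
    _ ≤ ∫⁻ h in Metric.ball (0 : 𝔼) (2 * R), ENNReal.ofReal (2 * R) * J :=
        setLIntegral_mono' measurableSet_ball hdiff
    _ = _ := by rw [setLIntegral_const]; ring

/-- A Poincaré inequality for `k(v)` where `v ∈ W_0^{1,p}(Ω, w)` and `k'` is bounded. -/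
theorem MemWeightedSobolevZero.lintegral_enorm_comp_sub_le {Ω : Set 𝔼} {p : ℝ} {w : 𝔼 → ℝ}
    (hw : IsWeightAp Ω p w) (hp : 1 < p) {v : 𝔼 → ℝ} {G : 𝔼 → 𝔼}
    (hv : MemWeightedSobolevZero Ω p w v G) {k : ℝ → ℝ} (hk : ContDiff ℝ ∞ k) {M : ℝ}
    (hM : ∀ t, |deriv k t| ≤ M) {z : 𝔼} {R : ℝ} (hR : 0 < R)
    (hball : Metric.closedBall z (3 * R) ⊆ Ω) :
    ∫⁻ q, ‖k (v q.2) - k (v q.1)‖ₑ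
        ∂((volume.restrict (Metric.ball z R)).prod (volume.restrict (Metric.ball z R))) ≤
      ENNReal.ofReal (2 * R) * volume (Metric.ball (0 : 𝔼) (2 * R)) *
        ∫⁻ x in Metric.closedBall z (3 * R), ‖deriv k (v x) • G x‖ₑ := by
  have hp0 : 0 < p := one_pos.trans hp
  obtain ⟨φ, hφ, hlim, hae⟩ := hv.exists_seq hw hp0
  have hK : IsCompact (Metric.closedBall z (3 * R)) := isCompact_closedBall _ _
  set K := Metric.closedBall z (3 * R) with hKdef
  have hBK : Metric.ball z R ⊆ K :=
    Metric.ball_subset_closedBall.trans (Metric.closedBall_subset_closedBall (by linarith))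
  have hKr : volume.restrict K ≤ volume.restrict Ω := Measure.restrict_mono hball le_rfl
  have hBr : volume.restrict (Metric.ball z R) ≤ volume.restrict Ω :=
    Measure.restrict_mono (hBK.trans hball) le_rfl
  have hvm := hv.memWeightedSobolev.hasWeakGradient.aestronglyMeasurable
  have hGm := hv.memWeightedSobolev.hasWeakGradient.aestronglyMeasurable_grad
  have hGK := hv.memWeightedSobolev.hasWeakGradient.locallyIntegrable_grad.integrableOn_compact_subset
    hball hK
  have hkc := hk.continuous
  have hkc' : Continuous (deriv k) := hk.continuous_deriv (by simp)
  have hφc := fun n => (hφ n).contDiff.continuous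
  obtain ⟨C, hC, hCle⟩ := hw.exists_lintegral_enorm_le hp hK hball
  have hCt : ENNReal.ofReal (2 * R) * volume (Metric.ball (0 : 𝔼) (2 * R)) ≠ ⊤ :=
    ENNReal.mul_ne_top ENNReal.ofReal_ne_top measure_ball_lt_top.ne
  have t1 : Tendsto (fun n => ∫⁻ x in K, ‖deriv k (φ n x) • G x‖ₑ) atTop
      (𝓝 (∫⁻ x in K, ‖deriv k (v x) • G x‖ₑ)) := by
    refine tendsto_lintegral_of_dominated_convergence' (fun x => ENNReal.ofReal M * ‖G x‖ₑ)
      (fun n => ?_) (fun n => ae_of_all _ fun x => ?_) ?_ ?_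
    · exact ((hkc'.comp (hφc n)).aestronglyMeasurable.smul hGK.1).enorm
    · simp only [enorm_smul]
      gcongr
      rw [Real.enorm_eq_ofReal_abs]
      exact ENNReal.ofReal_le_ofReal (hM _)
    · rw [lintegral_const_mul' _ _ (by simp)]
      exact ENNReal.mul_ne_top ENNReal.ofReal_ne_top hGK.2.ne
    · filter_upwards [ae_mono hKr hae] with x hx
      exact (((hkc'.tendsto _).comp hx).smul_const _).enorm
  have t2 := ENNReal.Tendsto.const_mul (a := ENNReal.ofReal M)
    (ENNReal.Tendsto.const_mul (a := C) hlim (Or.inr hC)) (Or.inr ENNReal.ofReal_ne_top)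
  have t3 := ENNReal.Tendsto.const_mul (a := _) (t1.add t2) (Or.inr hCt)
  simp only [mul_zero, add_zero] at t3
  -- Fatou on the left for `k (φ n)`. On the right, `‖∇ (k ∘ φ n)‖ ≤ ‖k'(φ n) • G‖ + M ‖G - ∇ (φ
  -- n)‖`: the first integral converges by dominated convergence, the second tends to zero.
  refine lintegral_le_of_tendsto_ae (f := fun n q => ‖k (φ n q.2) - k (φ n q.1)‖ₑ) (fun n => ?_) ?_
    (Eventually.of_forall fun n => ?_) t3
  · have := hφc n
    exact Continuous.aemeasurable (by fun_prop)
  · have h1 := Measure.quasiMeasurePreserving_fst (μ := volume.restrict (Metric.ball z R))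
      (ν := volume.restrict (Metric.ball z R)) |>.ae (ae_mono hBr hae)
    have h2 := Measure.quasiMeasurePreserving_snd (μ := volume.restrict (Metric.ball z R))
      (ν := volume.restrict (Metric.ball z R)) |>.ae (ae_mono hBr hae)
    filter_upwards [h1, h2] with q hq1 hq2
    exact (((hkc.tendsto _).comp hq2).sub ((hkc.tendsto _).comp hq1)).enorm
  · rw [lintegral_prod _ (Continuous.aemeasurable (by have := hφc n; fun_prop))]
    refine (lintegral_enorm_sub_le_lintegral_gradient (hk.comp (hφ n).contDiff) z).trans ?_
    refine mul_le_mul_right ?_ _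
    refine le_trans ?_ (add_le_add_right (mul_le_mul_right (hCle _
      (hGm.sub (continuous_gradient (hφ n).contDiff).aestronglyMeasurable)) _) _)
    rw [← lintegral_const_mul' _ _ (by simp), ← lintegral_add_left']
    · refine lintegral_mono fun x => ?_
      have e : ∇ (k ∘ φ n) x = deriv k (φ n x) • G x - deriv k (φ n x) • (G - ∇ (φ n)) x := by
        rw [show k ∘ φ n = fun y => k (φ n y) from rfl, gradient_comp hk (hφ n).contDiff,
          Pi.sub_apply]
        module
      rw [e]
      refine (enorm_sub_le).trans (add_le_add_right ?_ _)
      rw [enorm_smul]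
      gcongr
      rw [Real.enorm_eq_ofReal_abs]
      exact ENNReal.ofReal_le_ofReal (hM _)
    · exact ((hkc'.comp (hφc n)).aestronglyMeasurable.smul hGK.1).enorm

end Poincare

/-! ### Regularised powers and the pointwise Picone inequality -/

section Auxiliary

/-- For `b > 0`, `√((t + a)² + b²)` is smooth and at least `b` on the whole line, unlike `t + a`.
Its negative powers are therefore bounded with bounded derivative, without truncating the argument.
-/
theorem hasDerivAt_sqrt_sq_add {a b t : ℝ} (hb : 0 < b) :
    HasDerivAt (fun t => √((t + a) ^ 2 + b ^ 2)) ((t + a) / √((t + a) ^ 2 + b ^ 2)) t := by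
  have h1 : HasDerivAt (fun t : ℝ => (t + a) ^ 2 + b ^ 2) (2 * (t + a)) t := by
    simpa using (((hasDerivAt_id t).add_const a).pow 2).add_const (b ^ 2)
  convert h1.sqrt (by positivity) using 1
  field_simp

theorem hasDerivAt_sqrt_sq_add_rpow {a b t : ℝ} (hb : 0 < b) (m : ℝ) :
    HasDerivAt (fun t => √((t + a) ^ 2 + b ^ 2) ^ m)
      ((t + a) / √((t + a) ^ 2 + b ^ 2) * m * √((t + a) ^ 2 + b ^ 2) ^ (m - 1)) t :=
  (hasDerivAt_sqrt_sq_add hb).rpow_const (Or.inl (by positivity))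

theorem contDiff_sqrt_sq_add_rpow (a : ℝ) {b : ℝ} (hb : 0 < b) (m : ℝ) :
    ContDiff ℝ ∞ fun t => √((t + a) ^ 2 + b ^ 2) ^ m := by
  refine ContDiff.rpow_const_of_ne (ContDiff.sqrt (by fun_prop) fun t => ?_) fun t => ?_ <;>
    positivity

theorem le_sqrt_sq_add (x b : ℝ) : b ≤ √(x ^ 2 + b ^ 2) :=
  Real.le_sqrt_of_sq_le (by nlinarith [sq_nonneg x])

theorem abs_le_sqrt_sq_add (x b : ℝ) : |x| ≤ √(x ^ 2 + b ^ 2) :=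
  Real.abs_le_sqrt (by nlinarith [sq_nonneg b])

theorem abs_div_sqrt_sq_add_le_one (x b : ℝ) : |x / √(x ^ 2 + b ^ 2)| ≤ 1 := by
  rw [abs_div, abs_of_nonneg (Real.sqrt_nonneg _)]
  exact div_le_one_of_le₀ (abs_le_sqrt_sq_add x b) (Real.sqrt_nonneg _)

/-- Young's inequality with a parameter. -/
theorem mul_rpow_mul_le_rpow_add_rpow {p κ X Y : ℝ} (hp : 1 < p) (hκ : 0 < κ) (hX : 0 ≤ X)
    (hY : 0 ≤ Y) :
    p * (X ^ (p - 1) * Y) ≤ (p - 1) * κ * X ^ p + κ ^ (-(p - 1)) * Y ^ p := by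
  have hp0 : 0 < p := one_pos.trans hp
  have hp1 : p - 1 ≠ 0 := by linarith
  -- The two powers of `κ` cancel in the product and become `κ^(-(p-1))` and `κ` after raising to
  -- the conjugate exponents.
  have h := Real.young_inequality_of_nonneg (a := κ ^ (-((p - 1) / p)) * Y)
    (b := κ ^ ((p - 1) / p) * X ^ (p - 1)) (by positivity) (by positivity)
    (Real.HolderConjugate.conjExponent hp)
  have e1 : (κ ^ (-((p - 1) / p)) * Y) ^ p = κ ^ (-(p - 1)) * Y ^ p := by
    rw [Real.mul_rpow (by positivity) hY, ← Real.rpow_mul hκ.le]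
    congr 2
    field_simp
  have e2 : (κ ^ ((p - 1) / p) * X ^ (p - 1)) ^ (Real.conjExponent p) = κ * X ^ p := by
    rw [Real.mul_rpow (by positivity) (by positivity), ← Real.rpow_mul hκ.le, ← Real.rpow_mul hX,
      Real.conjExponent]
    have i1 : (p - 1) / p * (p / (p - 1)) = 1 := by field_simp
    have i2 : (p - 1) * (p / (p - 1)) = p := by field_simp
    rw [i1, i2, Real.rpow_one]
  have e3 : κ ^ (-((p - 1) / p)) * Y * (κ ^ ((p - 1) / p) * X ^ (p - 1)) = X ^ (p - 1) * Y := by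
    rw [mul_mul_mul_comm, ← Real.rpow_add hκ]
    simp [mul_comm]
  rw [e1, e2, e3, Real.conjExponent] at h
  calc p * (X ^ (p - 1) * Y)
      ≤ p * (κ ^ (-(p - 1)) * Y ^ p / p + κ * X ^ p / (p / (p - 1))) := by gcongr
    _ = _ := by field_simp; ring

/-- A pointwise Picone inequality. -/
theorem picone_inner_le {E : Type*} [NormedAddCommGroup E] [InnerProductSpace ℝ E]
    {p c κ g r σ d h h' : ℝ} {G D T : E} (hp : 1 < p) (hκ : 0 < κ) (hc : 0 < c) (hg : 0 ≤ g)
    (hr : 0 < r) (hσ : 0 ≤ σ) (hσg : σ ≤ g) (hσr : σ ≤ d * r)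
    (hh : h = r ^ (-(p - 1))) (hh' : h' ≤ -((p - 1) * c * r ^ (-p)))
    (hT : ‖T‖ ≤ p * g ^ (p - 1) * ‖D‖) :
    ‖G‖ ^ (p - 2) * inner ℝ G (h • T + ((g ^ p - σ ^ p) * h') • G) ≤
      κ ^ (-(p - 1)) * ‖D‖ ^ p - (p - 1) * (c - κ) * (g / r * ‖G‖) ^ p
        + (p - 1) * c * d ^ p * ‖G‖ ^ p := by
  have hp0 : 0 < p := one_pos.trans hp
  have hd : 0 ≤ d := by
    by_contra hd
    nlinarith
  have hR : 0 ≤ (p - 1) * c := mul_nonneg (by linarith) hc.le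
  by_cases hG : G = 0
  · subst hG
    simp only [inner_zero_left, mul_zero, norm_zero, Real.zero_rpow hp0.ne']
    have : 0 ≤ κ ^ (-(p - 1)) * ‖D‖ ^ p := by positivity
    simpa using this
  have hG0 : 0 < ‖G‖ := norm_pos_iff.2 hG
  have hθ : 0 ≤ g ^ p - σ ^ p := sub_nonneg.2 (Real.rpow_le_rpow hσ hσg hp0.le)
  have hh0 : 0 ≤ h := by rw [hh]; positivity
  have ep1 : ‖G‖ ^ (p - 2) * ‖G‖ = ‖G‖ ^ (p - 1) := by
    nth_rw 2 [← Real.rpow_one ‖G‖]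
    rw [← Real.rpow_add hG0]; congr 1; ring
  have ep2 : ‖G‖ ^ (p - 2) * ‖G‖ ^ 2 = ‖G‖ ^ p := by
    rw [← Real.rpow_natCast ‖G‖ 2, ← Real.rpow_add hG0]; congr 1; push_cast; ring
  have hY := mul_rpow_mul_le_rpow_add_rpow (X := g / r * ‖G‖) (Y := ‖D‖) hp hκ (by positivity)
    (norm_nonneg _)
  have eX : (g / r * ‖G‖) ^ (p - 1) = g ^ (p - 1) * h * ‖G‖ ^ (p - 1) := by
    rw [Real.mul_rpow (by positivity) (norm_nonneg _), Real.div_rpow hg hr.le, hh,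
      Real.rpow_neg hr.le, div_eq_mul_inv]
  have eX' : (g / r * ‖G‖) ^ p = g ^ p * r ^ (-p) * ‖G‖ ^ p := by
    rw [Real.mul_rpow (by positivity) (norm_nonneg _), Real.div_rpow hg hr.le,
      Real.rpow_neg hr.le, div_eq_mul_inv]
  -- Subtracting `σ^p` from `g^p` weakens the good negative term; since `σ ≤ d r`, the loss is at
  -- most a multiple of `d^p ‖G‖^p`.
  have hdp : σ ^ p * r ^ (-p) ≤ d ^ p := by
    rw [Real.rpow_neg hr.le, ← div_eq_mul_inv, ← Real.div_rpow hσ hr.le]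
    exact Real.rpow_le_rpow (by positivity) ((div_le_iff₀ hr).2 hσr) hp0.le
  have s1 : ‖G‖ ^ (p - 2) * inner ℝ G (h • T) ≤ p * ((g / r * ‖G‖) ^ (p - 1) * ‖D‖) := by
    calc ‖G‖ ^ (p - 2) * inner ℝ G (h • T)
        ≤ ‖G‖ ^ (p - 2) * (‖G‖ * (h * (p * g ^ (p - 1) * ‖D‖))) := by
          gcongr
          refine (real_inner_le_norm _ _).trans ?_
          rw [norm_smul, Real.norm_of_nonneg hh0]
          gcongr
      _ = (‖G‖ ^ (p - 2) * ‖G‖) * (h * (p * g ^ (p - 1) * ‖D‖)) := by ring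
      _ = _ := by rw [ep1, eX]; ring
  have s2 : ‖G‖ ^ (p - 2) * inner ℝ G (((g ^ p - σ ^ p) * h') • G) ≤
      -((p - 1) * c * (g / r * ‖G‖) ^ p) + (p - 1) * c * d ^ p * ‖G‖ ^ p := by
    rw [real_inner_smul_right, real_inner_self_eq_norm_sq]
    calc ‖G‖ ^ (p - 2) * ((g ^ p - σ ^ p) * h' * ‖G‖ ^ 2)
        = ((g ^ p - σ ^ p) * h') * (‖G‖ ^ (p - 2) * ‖G‖ ^ 2) := by ring
      _ = ((g ^ p - σ ^ p) * h') * ‖G‖ ^ p := by rw [ep2]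
      _ ≤ ((g ^ p - σ ^ p) * -((p - 1) * c * r ^ (-p))) * ‖G‖ ^ p := by gcongr
      _ = -((p - 1) * c * (g ^ p * r ^ (-p) * ‖G‖ ^ p))
          + (p - 1) * c * (σ ^ p * r ^ (-p)) * ‖G‖ ^ p := by ring
      _ ≤ _ := by rw [eX']; gcongr
  rw [inner_add_right, mul_add]
  linarith

end Auxiliary

/-! ### The integrated Picone inequality -/

section Estimate

variable {N : ℕ} {Ω : Set (EuclideanSpace ℝ (Fin N))} {p : ℝ}
  {w : EuclideanSpace ℝ (Fin N) → ℝ}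

local notation "𝔼" => EuclideanSpace ℝ (Fin N)

theorem IsTestFunction.comp_left {φ : 𝔼 → ℝ} (hφ : IsTestFunction Ω φ) {k : ℝ → ℝ}
    (hk : ContDiff ℝ ∞ k) (hk0 : k 0 = 0) : IsTestFunction Ω fun x => k (φ x) :=
  ⟨hk.comp hφ.contDiff, hφ.hasCompactSupport.comp_left hk0,
    (tsupport_comp_subset hk0 φ).trans hφ.tsupport_subset⟩

/-- Young's inequality with `κ = 1` dominates the integrand by `‖G‖^p + ‖H‖^p`. It makes the flux
pairing integrable, so the pointwise Picone inequality can be integrated. -/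
theorem integrable_norm_rpow_mul_inner {α E : Type*} [MeasurableSpace α] {ν : Measure α}
    [NormedAddCommGroup E] [InnerProductSpace ℝ E] {p : ℝ} (hp : 1 < p) {G H : α → E}
    (hG : MemLp G (ENNReal.ofReal p) ν) (hH : MemLp H (ENNReal.ofReal p) ν) :
    Integrable (fun x => ‖G x‖ ^ (p - 2) * inner ℝ (G x) (H x)) ν := by
  have hp0 : 0 < p := one_pos.trans hp
  have i1 := (integrable_norm_rpow_iff_memLp hp0 hG.1).2 hG
  have i2 := (integrable_norm_rpow_iff_memLp hp0 hH.1).2 hH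
  refine (i1.add i2).mono' ((hG.1.norm.aemeasurable.pow_const _).aestronglyMeasurable.mul
    (hG.1.inner hH.1)) (ae_of_all _ fun x => ?_)
  rw [norm_mul, Real.norm_of_nonneg (by positivity)]
  simp only [Pi.add_apply]
  -- The exponent `p - 2` may be negative, so powers combine only where `G x ≠ 0`; elsewhere the
  -- inner product vanishes.
  rcases eq_or_ne (G x) 0 with hx | hx
  · rw [hx, inner_zero_left, norm_zero, norm_zero, mul_zero]
    positivity
  have hG0 : 0 < ‖G x‖ := norm_pos_iff.2 hx
  have hY := mul_rpow_mul_le_rpow_add_rpow (X := ‖G x‖) (Y := ‖H x‖) hp one_pos (norm_nonneg _)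
    (norm_nonneg _)
  simp only [mul_one, Real.one_rpow, one_mul] at hY
  have ep1 : ‖G x‖ ^ (p - 2) * ‖G x‖ = ‖G x‖ ^ (p - 1) := by
    nth_rw 2 [← Real.rpow_one ‖G x‖]
    rw [← Real.rpow_add hG0]; congr 1; ring
  calc ‖G x‖ ^ (p - 2) * ‖inner ℝ (G x) (H x)‖
      ≤ ‖G x‖ ^ (p - 2) * (‖G x‖ * ‖H x‖) := by gcongr; exact norm_inner_le_norm _ _
    _ = ‖G x‖ ^ (p - 1) * ‖H x‖ := by rw [← mul_assoc, ep1]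
    _ ≤ ‖G x‖ ^ p + ‖H x‖ ^ p := by
      have a1 : 0 ≤ ‖G x‖ ^ p := by positivity
      have a2 : 0 ≤ ‖H x‖ ^ p := by positivity
      have a3 : 0 ≤ ‖G x‖ ^ (p - 1) * ‖H x‖ := by positivity
      nlinarith

theorem memLp_sqrt_div_sqrt_smul {v φ : 𝔼 → ℝ} {G : 𝔼 → 𝔼} {q : ENNReal}
    (hv : AEMeasurable v (volume.restrict Ω)) (hG : MemLp G q (weightedMeasure (volume.restrict Ω) w))
    (hGm : AEStronglyMeasurable G (volume.restrict Ω)) (hφ : IsTestFunction Ω φ) (a : ℝ) {b : ℝ}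
    (hb : 0 < b) (σ : ℝ) :
    MemLp (fun x => (√(φ x ^ 2 + σ ^ 2) / √((v x + a) ^ 2 + b ^ 2)) • G x) q
      (weightedMeasure (volume.restrict Ω) w) := by
  obtain ⟨M, -, hM⟩ := hφ.exists_bound
  have hm : AEStronglyMeasurable
      (fun x => √(φ x ^ 2 + σ ^ 2) / √((v x + a) ^ 2 + b ^ 2)) (volume.restrict Ω) := by
    refine AEMeasurable.aestronglyMeasurable ?_
    have hφm : AEMeasurable φ (volume.restrict Ω) := hφ.contDiff.continuous.aemeasurable
    fun_prop
  refine hG.of_le_mul (c := √(M ^ 2 + σ ^ 2) / b) ((hm.smul hGm).mono_ac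
    (weightedMeasure_absolutelyContinuous _ _)) (ae_of_all _ fun x => ?_)
  rw [norm_smul, Real.norm_of_nonneg (by positivity)]
  gcongr ?_ / ?_ * _
  · refine Real.sqrt_le_sqrt (add_le_add_left (sq_le_sq.2 ?_) _)
    exact (hM x).1.trans (le_abs_self _)
  · exact le_sqrt_sq_add _ _

/-- The integrated Picone inequality for a nonnegative solution `v`, tested against
`(√(φ² + σ²)^p - σ^p) / r(v)^{p-1}` with `r(t) = √((t + a)² + b²)` and `σ = d b`. -/
theorem picone_estimate (hw : IsWeightAp Ω p w) (hp : 1 < p) (hΩ : IsOpen Ω)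
    (hΩ' : Bornology.IsBounded Ω) {f v : 𝔼 → ℝ} {G : 𝔼 → 𝔼}
    (hv : MemWeightedSobolevZero Ω p w v G)
    (hsol : ∀ ψ H, MemWeightedSobolevZero Ω p w ψ H →
      ∫ x in Ω, w x * (‖G x‖ ^ (p - 2) * inner ℝ (G x) (H x)) =
          ∫ x in Ω, f x * (|v x| ^ (p - 2) * v x) * ψ x)
    (hv0 : ∀ᵐ x ∂(volume.restrict Ω), 0 ≤ v x) {φ : 𝔼 → ℝ} (hφ : IsTestFunction Ω φ)
    {a b c d κ : ℝ} (ha : 0 < a) (hb : 0 < b) (hc : 0 < c) (hd : 0 < d) (hκ : 0 < κ)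
    (hcab : c ^ 2 * (a ^ 2 + b ^ 2) ≤ a ^ 2) :
    (∫ x in Ω, f x * (|v x| ^ (p - 2) * v x) *
        ((√(φ x ^ 2 + (d * b) ^ 2) ^ p - (d * b) ^ p) *
          √((v x + a) ^ 2 + b ^ 2) ^ (-(p - 1)))) +
      (p - 1) * (c - κ) * ∫ x, (√(φ x ^ 2 + (d * b) ^ 2) / √((v x + a) ^ 2 + b ^ 2) * ‖G x‖) ^ p
        ∂(weightedMeasure (volume.restrict Ω) w) ≤
      κ ^ (-(p - 1)) * (∫ x, ‖∇ φ x‖ ^ p ∂(weightedMeasure (volume.restrict Ω) w)) +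
        (p - 1) * c * d ^ p * ∫ x, ‖G x‖ ^ p ∂(weightedMeasure (volume.restrict Ω) w) := by
  have hp0 : 0 < p := one_pos.trans hp
  set ν := weightedMeasure (volume.restrict Ω) w with hν
  have hac : ν ≪ volume.restrict Ω := weightedMeasure_absolutelyContinuous _ _
  have hσ : 0 < d * b := mul_pos hd hb
  set σ := d * b with hσdef
  set h : ℝ → ℝ := fun t => √((t + a) ^ 2 + b ^ 2) ^ (-(p - 1)) with hh
  set k : ℝ → ℝ := fun t => √(t ^ 2 + σ ^ 2) ^ p - σ ^ p with hk
  have hhs : ContDiff ℝ ∞ h := contDiff_sqrt_sq_add_rpow a hb _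
  have hks : ContDiff ℝ ∞ k := by
    simpa using (contDiff_sqrt_sq_add_rpow 0 hσ p).sub (contDiff_const (c := σ ^ p))
  have hk0 : k 0 = 0 := by simp [hk, Real.sqrt_sq hσ.le]
  have hhd : ∀ t, deriv h t = (t + a) / √((t + a) ^ 2 + b ^ 2) * (-(p - 1)) *
      √((t + a) ^ 2 + b ^ 2) ^ (-p) := fun t => by
    rw [(hasDerivAt_sqrt_sq_add_rpow hb _).deriv]; congr 2; ring
  have hkd : ∀ t, deriv k t = t / √(t ^ 2 + σ ^ 2) * p * √(t ^ 2 + σ ^ 2) ^ (p - 1) := fun t => by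
    have := (hasDerivAt_sqrt_sq_add_rpow (a := 0) (t := t) hσ p).sub_const (σ ^ p)
    simp only [add_zero] at this
    exact this.deriv
  have hpow : ∀ (t m : ℝ), 0 ≤ m → √((t + a) ^ 2 + b ^ 2) ^ (-m) ≤ b ^ (-m) := fun t m hm =>
    Real.rpow_le_rpow_of_nonpos hb (le_sqrt_sq_add _ _) (by linarith)
  -- The sum of the separate bounds on `h` and `h'` serves as a common bound for both.
  have hM : ∀ t, |h t| ≤ b ^ (-(p - 1)) + (p - 1) * b ^ (-p) ∧
      |deriv h t| ≤ b ^ (-(p - 1)) + (p - 1) * b ^ (-p) := by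
    intro t
    have q1 : 0 ≤ b ^ (-(p - 1)) := by positivity
    have q2 : 0 ≤ (p - 1) * b ^ (-p) := mul_nonneg (by linarith) (by positivity)
    constructor
    · rw [abs_of_nonneg (by positivity)]
      linarith [hpow t (p - 1) (by linarith)]
    · rw [hhd, abs_mul, abs_mul, abs_neg, abs_of_nonneg (by linarith : 0 ≤ p - 1),
        abs_of_nonneg (by positivity : 0 ≤ √((t + a) ^ 2 + b ^ 2) ^ (-p))]
      have := mul_le_mul (abs_div_sqrt_sq_add_le_one (t + a) b) (mul_le_mul_of_nonneg_left
        (hpow t p hp0.le) (by linarith : 0 ≤ p - 1)) (mul_nonneg (by linarith) (by positivity))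
        zero_le_one
      linarith
  have hθ : IsTestFunction Ω fun x => k (φ x) := hφ.comp_left hks hk0
  have hψ := hv.mul_comp hw hp hΩ hΩ' hθ hhs hM
  have heq := hsol _ _ hψ
  have hGp := hv.memWeightedSobolev.memLp_grad hw hp0
  have hvm := hv.memWeightedSobolev.hasWeakGradient.aestronglyMeasurable
  have hGm := hv.memWeightedSobolev.hasWeakGradient.aestronglyMeasurable_grad
  have hHp := hψ.memWeightedSobolev.memLp_grad hw hp0
  have i0 := integrable_norm_rpow_mul_inner hp hGp hHp
  have i1 := (integrable_norm_rpow_iff_memLp hp0 hGp.1).2 hGp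
  have i2 := (integrable_norm_rpow_iff_memLp hp0 (hw.memLp_gradient hφ 1).1).2
    (hw.memLp_gradient hφ (ENNReal.ofReal p))
  have i3 : Integrable (fun x => (√(φ x ^ 2 + σ ^ 2) / √((v x + a) ^ 2 + b ^ 2) * ‖G x‖) ^ p)
      ν := by
    have hmem := memLp_sqrt_div_sqrt_smul hvm.aemeasurable hGp hGm hφ a hb σ
    refine ((integrable_norm_rpow_iff_memLp hp0 hmem.1).2 hmem).congr (ae_of_all _ fun x => ?_)
    simp only
    rw [norm_smul, Real.norm_of_nonneg (by positivity)]
  have hmono := integral_mono_ae (μ := ν) i0 (((i2.const_mul (κ ^ (-(p - 1)))).sub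
      (i3.const_mul ((p - 1) * (c - κ)))).add (i1.const_mul ((p - 1) * c * d ^ p))) (by
    filter_upwards [hac.ae_le hv0] with x hx
    simp only [Pi.add_apply, Pi.sub_apply]
    have hr : 0 < √((v x + a) ^ 2 + b ^ 2) := by positivity
    refine picone_inner_le hp hκ hc (Real.sqrt_nonneg _) hr hσ.le
      (le_sqrt_sq_add _ _) ?_ rfl ?_ ?_
    · exact mul_le_mul_of_nonneg_left (le_sqrt_sq_add _ _) hd.le
    · rw [hhd]
      -- The quotient `(t + a) / r(t)` is smallest over `t ≥ 0` at `t = 0`, where the bound is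
      -- `hcab`. After squaring, the difference is `(1 - c²)(v² + 2 a v) ≥ 0` plus the slack in
      -- `hcab`.
      have hcr : c ≤ (v x + a) / √((v x + a) ^ 2 + b ^ 2) := by
        rw [le_div_iff₀ hr]
        refine le_of_sq_le_sq ?_ (by linarith)
        rw [mul_pow, Real.sq_sqrt (by positivity)]
        have hc1 : c ^ 2 ≤ 1 := by
          by_contra hc1
          nlinarith [sq_pos_of_pos ha, sq_pos_of_pos hb]
        nlinarith [mul_nonneg (sub_nonneg.2 hc1) (mul_nonneg hx ha.le),
          mul_nonneg (sub_nonneg.2 hc1) (sq_nonneg (v x))]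
      have := mul_le_mul_of_nonneg_right hcr (mul_nonneg (by linarith : 0 ≤ p - 1)
        (by positivity : 0 ≤ √((v x + a) ^ 2 + b ^ 2) ^ (-p)))
      linarith
    · rw [gradient_comp hks hφ.contDiff, norm_smul, hkd, norm_mul, norm_mul,
        Real.norm_of_nonneg hp0.le, Real.norm_of_nonneg (by positivity :
          0 ≤ √(φ x ^ 2 + σ ^ 2) ^ (p - 1))]
      gcongr
      exact mul_le_of_le_one_left hp0.le (abs_div_sqrt_sq_add_le_one _ _))
  rw [integral_weightedMeasure hw.aemeasurable hw.pos, heq] at hmono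
  rw [integral_add' ((i2.const_mul _).sub (i3.const_mul _)) (i1.const_mul _),
    integral_sub' (i2.const_mul _) (i3.const_mul _), integral_const_mul, integral_const_mul,
    integral_const_mul] at hmono
  linarith

end Estimate

/-! ### The strong maximum principle -/

section Positivity

variable {N : ℕ} {Ω : Set (EuclideanSpace ℝ (Fin N))} {p : ℝ}
  {w : EuclideanSpace ℝ (Fin N) → ℝ}

local notation "𝔼" => EuclideanSpace ℝ (Fin N)

/-- A substitute for the logarithm of `t + a` that is smooth on the whole line: its derivative is `1
/ r(t)` for `b = a`, the factor that the Picone estimate controls. -/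
theorem hasDerivAt_arsinh_add_div {a : ℝ} (ha : 0 < a) (t : ℝ) :
    HasDerivAt (fun t => Real.arsinh ((t + a) / a)) (√((t + a) ^ 2 + a ^ 2))⁻¹ t := by
  have h1 : HasDerivAt (fun t : ℝ => (t + a) / a) (1 / a) t :=
    ((hasDerivAt_id t).add_const a).div_const a
  convert h1.arsinh using 1
  have : (t + a) ^ 2 + a ^ 2 = a ^ 2 * (1 + ((t + a) / a) ^ 2) := by field_simp; ring
  rw [this, Real.sqrt_mul (by positivity), Real.sqrt_sq ha.le, smul_eq_mul, mul_inv, one_div,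
    mul_comm]

theorem tendsto_arsinh_atTop : Tendsto Real.arsinh atTop atTop := by
  refine tendsto_atTop_mono' _ ?_ Real.tendsto_log_atTop
  filter_upwards [eventually_gt_atTop 0] with x hx
  rw [Real.arsinh]
  exact Real.log_le_log hx (le_add_of_nonneg_right (Real.sqrt_nonneg _))

theorem ae_restrict_of_locally (hΩ : IsOpen Ω) {P : 𝔼 → Prop}
    (h : ∀ x ∈ Ω, ∃ V : Set 𝔼, IsOpen V ∧ x ∈ V ∧ ∀ᵐ y ∂(volume.restrict V), P y) :
    ∀ᵐ x ∂(volume.restrict Ω), P x := by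
  rw [ae_restrict_iff' hΩ.measurableSet, ae_iff]
  refine measure_null_of_locally_null _ fun x hx => ?_
  have hxΩ : x ∈ Ω := by
    by_contra h0
    exact hx fun h1 => absurd h1 h0
  obtain ⟨V, hV, hxV, hP⟩ := h x hxΩ
  rw [ae_restrict_iff' hV.measurableSet, ae_iff] at hP
  refine ⟨{y | ¬ (y ∈ V → P y)}, ?_, hP⟩
  filter_upwards [self_mem_nhdsWithin, mem_nhdsWithin_of_mem_nhds (hV.mem_nhds hxV)] with y hy hyV
  exact fun h1 => hy fun _ => h1 hyV

/-- Uniform bounds for the oscillation of the logarithm-like functions of `v` make the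
zero set or the positivity set of `v` null. -/
theorem ae_eq_zero_or_ae_pos_of_lintegral_le {α : Type*} [MeasurableSpace α] {μ : Measure α}
    [SFinite μ] {v : α → ℝ} (hv : AEStronglyMeasurable v μ) (hv0 : ∀ᵐ x ∂μ, 0 ≤ v x)
    {T : ENNReal} (hT : T ≠ ⊤)
    (h : ∀ a : ℝ, 0 < a → ∫⁻ q, ‖Real.arsinh ((v q.2 + a) / a) - Real.arsinh ((v q.1 + a) / a)‖ₑ
      ∂(μ.prod μ) ≤ T) :
    (∀ᵐ x ∂μ, v x = 0) ∨ ∀ᵐ x ∂μ, 0 < v x := by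
  set v' := hv.mk v with hv'
  have hvm : Measurable v' := hv.stronglyMeasurable_mk.measurable
  have hae : ∀ᵐ x ∂μ, v x = v' x := hv.ae_eq_mk
  have h1 := (Measure.quasiMeasurePreserving_fst (μ := μ) (ν := μ)).ae hae
  have h2 := (Measure.quasiMeasurePreserving_snd (μ := μ) (ν := μ)).ae hae
  let a : ℕ → ℝ := fun n => 1 / ((n : ℝ) + 1)
  have ha : ∀ n, 0 < a n := fun n => by positivity
  let F : ℕ → α × α → ENNReal := fun n q =>
    ‖Real.arsinh ((v' q.2 + a n) / a n) - Real.arsinh ((v' q.1 + a n) / a n)‖ₑ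
  have hF : ∀ n, Measurable (F n) := fun n =>
    ((Real.continuous_arsinh.measurable.comp (by fun_prop)).sub
      (Real.continuous_arsinh.measurable.comp (by fun_prop))).enorm
  have hle : ∫⁻ q, liminf (fun n => F n q) atTop ∂(μ.prod μ) ≤ T := by
    refine (lintegral_liminf_le hF).trans (liminf_le_of_frequently_le'
      (Frequently.of_forall fun n => le_trans (le_of_eq ?_) (h (a n) (ha n))))
    refine lintegral_congr_ae ?_
    filter_upwards [h1, h2] with q hq1 hq2
    rw [hq1, hq2]
  have hfin := ae_lt_top (Measurable.liminf hF) (hle.trans_lt hT.lt_top).ne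
  -- At a pair with `v' q.1 = 0 < v' q.2`, the first term is the constant `arsinh 1` while the
  -- second tends to infinity as `a → 0`. Fatou's bound excludes this for almost every pair.
  have hnot : ∀ᵐ q ∂(μ.prod μ), ¬ (v' q.1 = 0 ∧ 0 < v' q.2) := by
    filter_upwards [hfin] with q hq ⟨h0, hpos⟩
    have t1 : Tendsto (fun n : ℕ => ((v' q.2 + a n) / a n)) atTop atTop := by
      have e : ∀ n : ℕ, (v' q.2 + a n) / a n = v' q.2 * ((n : ℝ) + 1) + 1 := fun n => by
        simp only [a]; field_simp
      simp only [e]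
      exact tendsto_atTop_add_const_right _ _ (Tendsto.const_mul_atTop hpos
        (tendsto_atTop_add_const_right _ _ tendsto_natCast_atTop_atTop))
    have t2 : Tendsto (fun n => F n q) atTop (𝓝 ⊤) := by
      have e : ∀ n, F n q = ENNReal.ofReal
          |Real.arsinh ((v' q.2 + a n) / a n) + -Real.arsinh 1| := fun n => by
        simp only [F, h0, zero_add, div_self (ha n).ne', Real.enorm_eq_ofReal_abs, sub_eq_add_neg]
      simp only [e]
      exact ENNReal.tendsto_ofReal_atTop.comp (tendsto_abs_atTop_atTop.comp
        (tendsto_atTop_add_const_right _ _ (tendsto_arsinh_atTop.comp t1)))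
    rw [t2.liminf_eq] at hq
    exact lt_irrefl _ hq
  by_cases hz : ∀ᵐ x ∂μ, v' x ≠ 0
  · right
    filter_upwards [hae, hv0, hz] with x hx hx0 hxz
    exact lt_of_le_of_ne hx0 (by rw [hx]; exact hxz.symm)
  · left
    have hfreq : ∃ᶠ x in ae μ, v' x = 0 := (not_eventually.1 hz).mono fun _ => not_not.1
    -- By Fubini, some zero `x` of `v'` has the property that almost no `y` satisfies `v' y > 0`.
    obtain ⟨x, hx0, hx⟩ := (hfreq.and_eventually (Measure.ae_ae_of_ae_prod hnot)).exists
    filter_upwards [hx, hae, hv0] with y hy hy1 hy0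
    rw [hy1] at hy0 ⊢
    by_contra hne
    exact hy ⟨hx0, lt_of_le_of_ne hy0 (Ne.symm hne)⟩

/-- A nonnegative solution vanishes a.e. or is positive a.e. on small balls. -/
theorem ae_eq_zero_or_ae_pos_on_ball (hw : IsWeightAp Ω p w) (hp : 1 < p) (hΩ : IsOpen Ω)
    (hΩ' : Bornology.IsBounded Ω) {f v : 𝔼 → ℝ} {G : 𝔼 → 𝔼}
    (hv : MemWeightedSobolevZero Ω p w v G)
    (hsol : ∀ ψ H, MemWeightedSobolevZero Ω p w ψ H →
      ∫ x in Ω, w x * (‖G x‖ ^ (p - 2) * inner ℝ (G x) (H x)) =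
          ∫ x in Ω, f x * (|v x| ^ (p - 2) * v x) * ψ x)
    (hv0 : ∀ᵐ x ∂(volume.restrict Ω), 0 ≤ v x) (hf : ∀ᵐ x ∂(volume.restrict Ω), 0 ≤ f x)
    {z : 𝔼} {R : ℝ} (hR : 0 < R) (hball : Metric.closedBall z (4 * R) ⊆ Ω) :
    (∀ᵐ x ∂(volume.restrict (Metric.ball z R)), v x = 0) ∨
      ∀ᵐ x ∂(volume.restrict (Metric.ball z R)), 0 < v x := by
  have hp0 : 0 < p := one_pos.trans hp
  have hp1 : 0 < p - 1 := sub_pos.2 hp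
  have hK : Metric.closedBall z (3 * R) ⊆ Ω :=
    (Metric.closedBall_subset_closedBall (by linarith)).trans hball
  have hBr : volume.restrict (Metric.ball z R) ≤ volume.restrict Ω :=
    Measure.restrict_mono ((Metric.ball_subset_closedBall.trans
      (Metric.closedBall_subset_closedBall (by linarith))).trans hball) le_rfl
  have hvm := hv.memWeightedSobolev.hasWeakGradient.aestronglyMeasurable
  have hGm := hv.memWeightedSobolev.hasWeakGradient.aestronglyMeasurable_grad
  have hGp := hv.memWeightedSobolev.memLp_grad hw hp0
  -- The cutoff is 1 on the ball of radius `3R` needed by the Poincaré inequality and supported in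
  -- the ball of radius `4R`.
  let B : ContDiffBump z := ⟨3 * R, 4 * R, by positivity, by linarith⟩
  have hB : IsTestFunction Ω B := ⟨B.contDiff, B.hasCompactSupport, by
    rw [B.tsupport_eq]; exact hball⟩
  obtain ⟨C, hC, hCle⟩ := hw.exists_lintegral_enorm_le hp (isCompact_closedBall z (3 * R)) hK
  set ν := weightedMeasure (volume.restrict Ω) w with hν
  set A := ((4 : ℝ)⁻¹ ^ (-(p - 1)) * (∫ x, ‖∇ (B : 𝔼 → ℝ) x‖ ^ p ∂ν) +
    (p - 1) * 2⁻¹ * 1 ^ p * ∫ x, ‖G x‖ ^ p ∂ν) / ((p - 1) * 4⁻¹) with hA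
  have hest : ∀ a : ℝ, 0 < a →
      ∫⁻ x in Metric.closedBall z (3 * R), ‖(√((v x + a) ^ 2 + a ^ 2))⁻¹ • G x‖ₑ ≤
        C * ENNReal.ofReal (A ^ (1 / p)) := by
    intro a ha
    -- With `a = b`, the requirement on `c` is `2 c² ≤ 1`, met by `c = 1/2`. Taking `κ = 1/4 < c`
    -- keeps a positive coefficient `(p - 1)/4` on the gradient term. No term on the right depends
    -- on `a`, so `A` is uniform; the zero order term is dropped because `f ≥ 0`.
    have hP := picone_estimate hw hp hΩ hΩ' hv hsol hv0 hB ha ha (c := 2⁻¹) (d := 1) (κ := 4⁻¹)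
      (by positivity) one_pos (by positivity) (by nlinarith [sq_nonneg a])
    have hmem := memLp_sqrt_div_sqrt_smul hvm.aemeasurable hGp hGm hB a ha (1 * a)
    have hpos : 0 ≤ ∫ x in Ω, f x * (|v x| ^ (p - 2) * v x) *
        ((√(B x ^ 2 + (1 * a) ^ 2) ^ p - (1 * a) ^ p) *
          √((v x + a) ^ 2 + a ^ 2) ^ (-(p - 1))) := by
      refine integral_nonneg_of_ae ?_
      filter_upwards [hv0, hf] with x hx hfx
      have : 0 ≤ √(B x ^ 2 + (1 * a) ^ 2) ^ p - (1 * a) ^ p :=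
        sub_nonneg.2 (Real.rpow_le_rpow (by positivity) (le_sqrt_sq_add _ _) hp0.le)
      simp only [Pi.zero_apply]
      positivity
    have hint : ∫ x, (√(B x ^ 2 + (1 * a) ^ 2) / √((v x + a) ^ 2 + a ^ 2) * ‖G x‖) ^ p ∂ν ≤ A := by
      rw [hA, le_div_iff₀ (by positivity)]
      have e : (2 : ℝ)⁻¹ - 4⁻¹ = 4⁻¹ := by norm_num
      rw [e] at hP
      linarith
    have hnorm : eLpNorm (fun x => (√(B x ^ 2 + (1 * a) ^ 2) / √((v x + a) ^ 2 + a ^ 2)) • G x)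
        (ENNReal.ofReal p) ν ≤ ENNReal.ofReal (A ^ (1 / p)) := by
      rw [hmem.eLpNorm_eq_integral_rpow_norm (by simpa using hp0) (by simp),
        ENNReal.toReal_ofReal hp0.le, one_div]
      refine ENNReal.ofReal_le_ofReal (Real.rpow_le_rpow
        (integral_nonneg fun x => by positivity) (le_trans (le_of_eq ?_) hint) (by positivity))
      refine integral_congr_ae (ae_of_all _ fun x => ?_)
      simp only
      rw [norm_smul, Real.norm_of_nonneg (by positivity)]
    refine le_trans ?_ ((hCle _ (hmem.1.mono_ac
      (absolutelyContinuous_weightedMeasure hw.aemeasurable hw.pos))).trans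
      (mul_le_mul_right hnorm _))
    refine setLIntegral_mono' measurableSet_closedBall fun x hx => ?_
    have hBx : B x = 1 := B.one_of_mem_closedBall hx
    rw [enorm_le_iff_norm_le, norm_smul, norm_smul, Real.norm_of_nonneg (by positivity),
      Real.norm_of_nonneg (by positivity), hBx, ← one_div]
    gcongr
    exact (le_abs_self _).trans (abs_le_sqrt_sq_add _ _)
  refine ae_eq_zero_or_ae_pos_of_lintegral_le (hvm.mono_measure hBr) (ae_mono hBr hv0)
    (T := ENNReal.ofReal (2 * R) * volume (Metric.ball (0 : 𝔼) (2 * R)) *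
      (C * ENNReal.ofReal (A ^ (1 / p)))) ?_ fun a ha => ?_
  · exact ENNReal.mul_ne_top (ENNReal.mul_ne_top ENNReal.ofReal_ne_top measure_ball_lt_top.ne)
      (ENNReal.mul_ne_top hC ENNReal.ofReal_ne_top)
  · have hd : ∀ t, deriv (fun t => Real.arsinh ((t + a) / a)) t = (√((t + a) ^ 2 + a ^ 2))⁻¹ :=
      fun t => (hasDerivAt_arsinh_add_div ha t).deriv
    have hpc := hv.lintegral_enorm_comp_sub_le hw hp (k := fun t => Real.arsinh ((t + a) / a))
      (M := a⁻¹) (by fun_prop) (fun t => ?_) hR hK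
    · refine hpc.trans (mul_le_mul_right ?_ _)
      simp only [hd]
      exact hest a ha
    · rw [hd, abs_of_nonneg (by positivity)]
      gcongr
      exact le_sqrt_sq_add _ _

/-- A strong maximum principle: a nontrivial nonnegative solution is positive a.e. -/
theorem ae_pos_of_nonneg_of_ne_zero (hw : IsWeightAp Ω p w) (hp : 1 < p) (hΩ : IsOpen Ω)
    (hΩc : IsPreconnected Ω) (hΩ' : Bornology.IsBounded Ω) {f v : 𝔼 → ℝ} {G : 𝔼 → 𝔼}
    (hv : MemWeightedSobolevZero Ω p w v G)
    (hsol : ∀ ψ H, MemWeightedSobolevZero Ω p w ψ H →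
      ∫ x in Ω, w x * (‖G x‖ ^ (p - 2) * inner ℝ (G x) (H x)) =
          ∫ x in Ω, f x * (|v x| ^ (p - 2) * v x) * ψ x)
    (hv0 : ∀ᵐ x ∂(volume.restrict Ω), 0 ≤ v x) (hf : ∀ᵐ x ∂(volume.restrict Ω), 0 ≤ f x)
    (hne : ¬ ∀ᵐ x ∂(volume.restrict Ω), v x = 0) :
    ∀ᵐ x ∂(volume.restrict Ω), 0 < v x := by
  -- `U P` is the open set of points near which `P (v y)` holds a.e. The sets for `v = 0` and `v >
  -- 0` cover `Ω` and are disjoint, since nonempty open sets have positive measure.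
  let U : (ℝ → Prop) → Set 𝔼 := fun P =>
    {x | ∃ V : Set 𝔼, IsOpen V ∧ x ∈ V ∧ ∀ᵐ y ∂(volume.restrict V), P (v y)}
  have hU : ∀ P, IsOpen (U P) := fun P => by
    refine isOpen_iff_mem_nhds.2 fun x ⟨V, hV, hxV, hP⟩ => ?_
    filter_upwards [hV.mem_nhds hxV] with y hy
    exact ⟨V, hV, hy, hP⟩
  have hcover : Ω ⊆ U (fun t => t = 0) ∪ U (fun t => 0 < t) := by
    intro z hz
    obtain ⟨r, hr, hball⟩ := Metric.nhds_basis_closedBall.mem_iff.1 (hΩ.mem_nhds hz)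
    have hR : 0 < r / 4 := by positivity
    have := ae_eq_zero_or_ae_pos_on_ball hw hp hΩ hΩ' hv hsol hv0 hf (z := z) hR
      (by rwa [mul_div_cancel₀ r four_ne_zero])
    exact this.imp (fun h => ⟨_, Metric.isOpen_ball, Metric.mem_ball_self hR, h⟩)
      fun h => ⟨_, Metric.isOpen_ball, Metric.mem_ball_self hR, h⟩
  have hdisj : Ω ∩ (U (fun t => t = 0) ∩ U (fun t => 0 < t)) = ∅ := by
    refine Set.eq_empty_of_forall_notMem ?_
    rintro x ⟨-, ⟨V, hV, hxV, hP⟩, W, hW, hxW, hQ⟩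
    have hlt := (hV.inter hW).measure_pos volume ⟨x, hxV, hxW⟩
    have h1 := ae_mono (Measure.restrict_mono (Set.inter_subset_left (s := V) (t := W)) le_rfl) hP
    have h2 := ae_mono (Measure.restrict_mono (Set.inter_subset_right (s := V) (t := W)) le_rfl) hQ
    have : ∀ᵐ y ∂(volume.restrict (V ∩ W)), False := by
      filter_upwards [h1, h2] with y hy1 hy2
      exact hy2.ne' hy1
    rw [ae_iff] at this
    simp only [not_false_eq_true, Set.ofPred_true, Measure.restrict_apply_univ] at this
    exact hlt.ne' this
  rcases isPreconnected_iff_subset_of_disjoint.1 hΩc _ _ (hU fun t => t = 0) (hU fun t => 0 < t) hcover hdisj with h | h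
  · exact absurd (ae_restrict_of_locally hΩ h) hne
  · exact ae_restrict_of_locally hΩ h

end Positivity

/-! ### Comparison of the two equations -/

section Comparison

variable {N : ℕ} {Ω : Set (EuclideanSpace ℝ (Fin N))} {p : ℝ}
  {w : EuclideanSpace ℝ (Fin N) → ℝ}

local notation "𝔼" => EuclideanSpace ℝ (Fin N)

theorem gradient_neg_fun (φ : 𝔼 → ℝ) (x : 𝔼) : ∇ (fun y => -φ y) x = -∇ φ x := by
  simp [gradient, fderiv_fun_neg]

theorem MemWeightedSobolevZero.neg {u : 𝔼 → ℝ} {G : 𝔼 → 𝔼} (h : MemWeightedSobolevZero Ω p w u G) :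
    MemWeightedSobolevZero Ω p w (fun x => -u x) fun x => -G x := by
  obtain ⟨⟨⟨h1, h2, h3⟩, h4, h5⟩, φ, hφ, hlim⟩ := h
  refine ⟨⟨⟨h1.neg, h2.neg, fun η hη i => ?_⟩, by simpa using h4, by simpa using h5⟩,
    fun n x => -φ n x, fun n => ⟨(hφ n).contDiff.neg, (hφ n).hasCompactSupport.neg, ?_⟩, ?_⟩
  · simp only [neg_mul, PiLp.neg_apply, integral_neg, h3 η hη i]
  · exact (closure_mono (by simp)).trans (hφ n).tsupport_subset
  · refine hlim.congr fun n => ?_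
    simp only [weightedSobolevNorm, gradient_neg_fun]
    have e1 : ∀ x, |-u x - -φ n x| = |u x - φ n x| := fun x => by
      rw [← abs_neg]; congr 1; ring
    have e2 : ∀ x, ‖-G x - -∇ (φ n) x‖ = ‖G x - ∇ (φ n) x‖ := fun x => by
      rw [← norm_neg]; congr 1; abel
    simp only [e1, e2]

theorem IsDirichletSolution.neg {f u : 𝔼 → ℝ} (h : IsDirichletSolution Ω p w f u) :
    IsDirichletSolution Ω p w f fun x => -u x := by
  obtain ⟨G, hG, hsol⟩ := h
  refine ⟨fun x => -G x, hG.neg, fun ψ H hψ => ?_⟩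
  obtain ⟨h1, h2⟩ := hsol ψ H hψ
  refine ⟨?_, ?_⟩
  · simpa [neg_mul, mul_neg] using h1.neg
  · simp only [norm_neg, inner_neg_left, abs_neg, mul_neg, neg_mul, integral_neg, h2]

theorem abs_rpow_sub_two_mul_mul_self (hp : 1 < p) (t : ℝ) : |t| ^ (p - 2) * t * t = |t| ^ p := by
  rcases eq_or_ne t 0 with rfl | ht
  · simp [Real.zero_rpow (by linarith : p ≠ 0)]
  · have h0 : 0 < |t| := abs_pos.2 ht
    rw [mul_assoc, ← abs_mul_abs_self, ← pow_two, ← Real.rpow_natCast |t| 2, ← Real.rpow_add h0]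
    congr 1; push_cast; ring

theorem norm_rpow_sub_two_mul_inner_self {E : Type*} [NormedAddCommGroup E] [InnerProductSpace ℝ E]
    (hp : 1 < p) (g : E) : ‖g‖ ^ (p - 2) * inner ℝ g g = ‖g‖ ^ p := by
  rw [real_inner_self_eq_norm_sq, pow_two, ← mul_assoc]
  simpa using abs_rpow_sub_two_mul_mul_self hp ‖g‖

theorem rpow_sub_two_mul_self {t : ℝ} (ht : 0 < t) : |t| ^ (p - 2) * t = t ^ (p - 1) := by
  rw [abs_of_pos ht]
  nth_rw 2 [← Real.rpow_one t]
  rw [← Real.rpow_add ht]; congr 1; ring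

/-- The Picone-type comparison of the zero order terms for a positive solution `v`, and a function
`u ∈ W_0^{1,p}(Ω, w₁)`. -/
theorem lintegral_mul_rpow_le (hp : 1 < p) (hΩ : IsOpen Ω) (hΩ' : Bornology.IsBounded Ω)
    {w₁ w₂ f u v : 𝔼 → ℝ} {Gu G : 𝔼 → 𝔼} (hw₁ : IsWeightAp Ω p w₁) (hw₂ : IsWeightAp Ω p w₂)
    (hw : ∀ᵐ x ∂(volume.restrict Ω), w₂ x ≤ w₁ x)
    (hf : IntegrableOn f Ω) (hf0 : ∀ᵐ x ∂(volume.restrict Ω), 0 ≤ f x)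
    (hu : MemWeightedSobolevZero Ω p w₁ u Gu) (hv : MemWeightedSobolevZero Ω p w₂ v G)
    (hsol : ∀ ψ H, MemWeightedSobolevZero Ω p w₂ ψ H →
      ∫ x in Ω, w₂ x * (‖G x‖ ^ (p - 2) * inner ℝ (G x) (H x)) =
          ∫ x in Ω, f x * (|v x| ^ (p - 2) * v x) * ψ x)
    (hv0 : ∀ᵐ x ∂(volume.restrict Ω), 0 < v x) :
    ∫⁻ x in Ω, ENNReal.ofReal (f x * |u x| ^ p) ≤
      ENNReal.ofReal (∫ x in Ω, w₁ x * ‖Gu x‖ ^ p) := by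
  have hp0 : 0 < p := one_pos.trans hp
  have hp1 : 0 < p - 1 := sub_pos.2 hp
  obtain ⟨φ, hφ, hlim, hae⟩ := hu.exists_seq hw₁ hp0
  have hvm := hv.memWeightedSobolev.hasWeakGradient.aestronglyMeasurable.aemeasurable
  have hGu := hu.memWeightedSobolev.memLp_grad hw₁ hp0
  set ν₁ := weightedMeasure (volume.restrict Ω) w₁ with hν₁
  set ν₂ := weightedMeasure (volume.restrict Ω) w₂ with hν₂
  have hν : ν₂ ≤ ν₁ := weightedMeasure_mono hw
  have hφL := fun n => hw₁.memLp_gradient (hφ n) (ENNReal.ofReal p)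
  set A := (eLpNorm Gu (ENNReal.ofReal p) ν₁).toReal with hA
  have hAp : ∫ x in Ω, w₁ x * ‖Gu x‖ ^ p = A ^ p := by
    rw [hA, ← integral_norm_rpow_eq hp0 hGu, integral_weightedMeasure hw₁.aemeasurable hw₁.pos]
  let B : ℕ → ℝ := fun n =>
    (eLpNorm (Gu - ∇ (φ n)) (ENNReal.ofReal p) ν₁).toReal
  have hB : Tendsto B atTop (𝓝 0) := by
    have := (ENNReal.tendsto_toReal_iff (fun n => (hGu.sub (hφL n)).2.ne)
      ENNReal.zero_ne_top).2 hlim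
    rwa [ENNReal.toReal_zero] at this
  -- The ordering of the weights enters here, through `ν₂ ≤ ν₁`; Minkowski then compares `∇ (φ n)`
  -- with `Gu`.
  have hgrad : ∀ n, ∫ x, ‖∇ (φ n) x‖ ^ p ∂ν₂ ≤ (A + B n) ^ p := by
    intro n
    refine (integral_mono_measure hν (ae_of_all _ fun x => by positivity)
      ((integrable_norm_rpow_iff_memLp hp0 (hφL n).1).2 (hφL n))).trans ?_
    rw [integral_norm_rpow_eq hp0 (hφL n)]
    refine Real.rpow_le_rpow ENNReal.toReal_nonneg ?_ hp0.le
    rw [hA, ← ENNReal.toReal_add hGu.2.ne (hGu.sub (hφL n)).2.ne]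
    refine ENNReal.toReal_mono (ENNReal.add_ne_top.2 ⟨hGu.2.ne, (hGu.sub (hφL n)).2.ne⟩) ?_
    calc eLpNorm (∇ (φ n)) (ENNReal.ofReal p) ν₁
        = eLpNorm (Gu - (Gu - ∇ (φ n))) (ENNReal.ofReal p) ν₁ := by rw [sub_sub_cancel]
      _ ≤ _ := eLpNorm_sub_le hGu.1 (hGu.sub (hφL n)).1 (by simpa using hp.le)
  let ε : ℕ → ℝ := fun n => 1 / ((n : ℝ) + 1)
  have hε : ∀ n, 0 < ε n := fun n => by positivity
  have hε0 : Tendsto ε atTop (𝓝 0) := tendsto_one_div_add_atTop_nhds_zero_nat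
  -- The largest `c` allowed by `c² (a² + b²) ≤ a²` when `a = ε` and `b = ε²`. Since `b / a → 0`, it
  -- tends to 1, so `κ = c` gives the sharp constant in the limit.
  let c : ℕ → ℝ := fun n => (√(1 + ε n ^ 2))⁻¹
  have hc : ∀ n, 0 < c n := fun n => by positivity
  have hc1 : Tendsto c atTop (𝓝 1) := by
    have := (((hε0.pow 2).const_add 1).sqrt).inv₀ (by simp)
    simpa using this
  let g : ℕ → 𝔼 → ℝ := fun n x => f x * (|v x| ^ (p - 2) * v x) *
    ((√(φ n x ^ 2 + (ε n * ε n ^ 2) ^ 2) ^ p - (ε n * ε n ^ 2) ^ p) *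
      √((v x + ε n) ^ 2 + (ε n ^ 2) ^ 2) ^ (-(p - 1)))
  have hθ0 : ∀ n x, 0 ≤ √(φ n x ^ 2 + (ε n * ε n ^ 2) ^ 2) ^ p - (ε n * ε n ^ 2) ^ p := fun n x =>
    sub_nonneg.2 (Real.rpow_le_rpow (by have := hε n; positivity) (le_sqrt_sq_add _ _) hp0.le)
  have hg0 : ∀ n, ∀ᵐ x ∂(volume.restrict Ω), 0 ≤ g n x := by
    intro n
    filter_upwards [hv0, hf0] with x hx hfx
    have := hθ0 n x
    positivity
  have hgm : ∀ n, AEMeasurable (g n) (volume.restrict Ω) := by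
    intro n
    have h1 : AEMeasurable (φ n) (volume.restrict Ω) := (hφ n).contDiff.continuous.aemeasurable
    have h2 := hf.1.aemeasurable
    have h3 : AEMeasurable (fun x => |v x|) (volume.restrict Ω) := hvm.norm
    fun_prop
  have hgi : ∀ n, Integrable (g n) (volume.restrict Ω) := by
    intro n
    obtain ⟨M, hM0, hM⟩ := (hφ n).exists_bound
    refine (hf.mul_const (√(M ^ 2 + (ε n * ε n ^ 2) ^ 2) ^ p)).mono'
      (hgm n).aestronglyMeasurable ?_
    filter_upwards [hv0, hf0, hg0 n] with x hx hfx hgx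
    rw [Real.norm_of_nonneg hgx]
    simp only [g]
    rw [mul_assoc]
    refine mul_le_mul_of_nonneg_left ?_ hfx
    have hθM : √(φ n x ^ 2 + (ε n * ε n ^ 2) ^ 2) ^ p - (ε n * ε n ^ 2) ^ p ≤
        √(M ^ 2 + (ε n * ε n ^ 2) ^ 2) ^ p := by
      have h1 : √(φ n x ^ 2 + (ε n * ε n ^ 2) ^ 2) ^ p ≤ √(M ^ 2 + (ε n * ε n ^ 2) ^ 2) ^ p :=
        Real.rpow_le_rpow (Real.sqrt_nonneg _) (Real.sqrt_le_sqrt (add_le_add_left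
          (sq_le_sq.2 ((hM x).1.trans (le_abs_self _))) _)) hp0.le
      have h2 : 0 ≤ (ε n * ε n ^ 2) ^ p := by have := hε n; positivity
      linarith
    -- Because `v ≤ r(v)`, the singular power is compensated and `g n` is dominated by a constant
    -- multiple of `f`.
    have hvr : (|v x| ^ (p - 2) * v x) * √((v x + ε n) ^ 2 + (ε n ^ 2) ^ 2) ^ (-(p - 1)) ≤ 1 := by
      have hr : v x ≤ √((v x + ε n) ^ 2 + (ε n ^ 2) ^ 2) := by
        refine le_trans ?_ (abs_le_sqrt_sq_add _ _)
        exact (by linarith [hε n] : v x ≤ v x + ε n).trans (le_abs_self _)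
      rw [rpow_sub_two_mul_self hx, Real.rpow_neg (Real.sqrt_nonneg _), ← div_eq_mul_inv]
      exact div_le_one_of_le₀ (Real.rpow_le_rpow hx.le hr hp1.le) (by positivity)
    calc _ = ((|v x| ^ (p - 2) * v x) * √((v x + ε n) ^ 2 + (ε n ^ 2) ^ 2) ^ (-(p - 1))) *
          (√(φ n x ^ 2 + (ε n * ε n ^ 2) ^ 2) ^ p - (ε n * ε n ^ 2) ^ p) := by ring
      _ ≤ 1 * √(M ^ 2 + (ε n * ε n ^ 2) ^ 2) ^ p :=
          mul_le_mul hvr hθM (hθ0 n x) zero_le_one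
      _ = _ := one_mul _
  set D := ∫ x, ‖G x‖ ^ p ∂ν₂ with hD
  have hle : ∀ n, ∫⁻ x in Ω, ENNReal.ofReal (g n x) ≤
      ENNReal.ofReal (c n ^ (-(p - 1)) * (A + B n) ^ p + (p - 1) * c n * ε n ^ p * D) := by
    intro n
    rw [← ofReal_integral_eq_lintegral_ofReal (hgi n) (hg0 n)]
    refine ENNReal.ofReal_le_ofReal ?_
    -- The choice `κ = c` removes the gradient term on the left, and `d = ε` makes the remaining
    -- error of order `ε^p`.
    have hP := picone_estimate hw₂ hp hΩ hΩ' hv hsol (hv0.mono fun _ h => h.le) (hφ n)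
      (a := ε n) (b := ε n ^ 2) (c := c n) (d := ε n) (κ := c n) (hε n) (pow_pos (hε n) 2) (hc n)
      (hε n) (hc n) (le_of_eq (by
        simp only [c]
        rw [inv_pow, Real.sq_sqrt (by positivity)]
        field_simp))
    rw [sub_self, mul_zero, zero_mul, add_zero] at hP
    refine hP.trans ?_
    have := hc n
    gcongr
    exact hgrad n
  rw [hAp]
  -- Fatou: `g n → f |u|^p` a.e., where the limit uses `v > 0` to cancel `v^(p-1)`, while the bounds
  -- tend to `A^p`.
  refine lintegral_le_of_tendsto_ae (f := fun n x => ENNReal.ofReal (g n x))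
    (fun n => (hgm n).ennreal_ofReal) ?_ (Eventually.of_forall hle) ?_
  · filter_upwards [hv0, hae] with x hx hφx
    refine ENNReal.tendsto_ofReal ?_
    have hb : Tendsto (fun n => ε n * ε n ^ 2) atTop (𝓝 0) := by
      simpa using hε0.mul (hε0.pow 2)
    have l1 : Tendsto (fun n => √(φ n x ^ 2 + (ε n * ε n ^ 2) ^ 2) ^ p - (ε n * ε n ^ 2) ^ p) atTop
        (𝓝 (|u x| ^ p)) := by
      have := ((((hφx.pow 2).add (hb.pow 2)).sqrt).rpow_const (p := p) (Or.inr hp0.le)).sub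
        (hb.rpow_const (p := p) (Or.inr hp0.le))
      simpa [Real.zero_rpow hp0.ne', Real.sqrt_sq_eq_abs] using this
    have l2 : Tendsto (fun n => √((v x + ε n) ^ 2 + (ε n ^ 2) ^ 2) ^ (-(p - 1))) atTop
        (𝓝 (v x ^ (-(p - 1)))) := by
      have h0 : Tendsto (fun n => √((v x + ε n) ^ 2 + (ε n ^ 2) ^ 2)) atTop (𝓝 (v x)) := by
        have := (((hε0.const_add (v x)).pow 2).add ((hε0.pow 2).pow 2)).sqrt
        simpa [Real.sqrt_sq hx.le] using this
      exact h0.rpow_const (Or.inl hx.ne')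
    have := (l1.mul l2).const_mul (f x * (|v x| ^ (p - 2) * v x))
    convert this using 2
    rw [rpow_sub_two_mul_self hx, mul_assoc, mul_left_comm (v x ^ (p - 1)),
      ← Real.rpow_add hx, add_neg_cancel, Real.rpow_zero, mul_one]
  · refine ENNReal.tendsto_ofReal ?_
    have l1 : Tendsto (fun n => c n ^ (-(p - 1))) atTop (𝓝 1) := by
      simpa using hc1.rpow_const (p := -(p - 1)) (Or.inl one_ne_zero)
    have l2 : Tendsto (fun n => (A + B n) ^ p) atTop (𝓝 (A ^ p)) := by
      simpa using (hB.const_add A).rpow_const (p := p) (Or.inr hp0.le)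
    have l3 : Tendsto (fun n => (p - 1) * c n * ε n ^ p * D) atTop (𝓝 0) := by
      have := ((hc1.const_mul (p - 1)).mul (hε0.rpow_const (p := p) (Or.inr hp0.le))).mul_const D
      simpa [Real.zero_rpow hp0.ne'] using this
    simpa using (l1.mul l2).add l3

/-- There is no nontrivial nonnegative solution of the problem with the larger right-hand side. -/
theorem false_of_nonneg_solution (hΩ : IsOpen Ω) (hΩc : IsPreconnected Ω)
    (hΩ' : Bornology.IsBounded Ω) (hp : 1 < p) {w₁ w₂ f₁ f₂ u v : 𝔼 → ℝ}
    (hw₁ : IsWeightAp Ω p w₁) (hw₂ : IsWeightAp Ω p w₂)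
    (hw : ∀ᵐ x ∂(volume.restrict Ω), w₂ x ≤ w₁ x) (hf₂ : IntegrableOn f₂ Ω)
    (hf : ∀ᵐ x ∂(volume.restrict Ω), 0 ≤ f₁ x ∧ f₁ x < f₂ x)
    (hu_ne : ¬ ∀ᵐ x ∂(volume.restrict Ω), u x = 0) (hu : IsDirichletSolution Ω p w₁ f₁ u)
    (hv_ne : ¬ ∀ᵐ x ∂(volume.restrict Ω), v x = 0) (hv : IsDirichletSolution Ω p w₂ f₂ v)
    (hv0 : ∀ᵐ x ∂(volume.restrict Ω), 0 ≤ v x) : False := by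
  have hp0 : 0 < p := one_pos.trans hp
  obtain ⟨Gu, hGu, hsolu⟩ := hu
  obtain ⟨G, hG, hsolv⟩ := hv
  have hf0 : ∀ᵐ x ∂(volume.restrict Ω), 0 ≤ f₂ x := hf.mono fun x hx => hx.1.trans hx.2.le
  have hsol := fun ψ H h => (hsolv ψ H h).2
  have hvpos := ae_pos_of_nonneg_of_ne_zero hw₂ hp hΩ hΩc hΩ' hG hsol hv0 hf0 hv_ne
  have hle := lintegral_mul_rpow_le hp hΩ hΩ' hw₁ hw₂ hw hf₂ hf0 hGu hG hsol hvpos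
  -- Testing with `u` itself turns the gradient energy into `∫ f₁ |u|^p`, and also shows that this
  -- integral is finite.
  obtain ⟨hint, heq⟩ := hsolu u Gu hGu
  simp only [norm_rpow_sub_two_mul_inner_self hp, mul_assoc (f₁ _),
    abs_rpow_sub_two_mul_mul_self hp] at hint heq
  have h1 : ∀ᵐ x ∂(volume.restrict Ω), 0 ≤ f₁ x * |u x| ^ p :=
    hf.mono fun x hx => mul_nonneg hx.1 (by positivity)
  rw [heq, ofReal_integral_eq_lintegral_ofReal hint h1] at hle
  have hum : AEMeasurable (fun x => |u x|) (volume.restrict Ω) :=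
    hGu.memWeightedSobolev.hasWeakGradient.aestronglyMeasurable.aemeasurable.norm
  -- The pointwise inequality `f₁ |u|^p ≤ f₂ |u|^p` and the reverse inequality of finite integrals
  -- give equality a.e.
  have hae := ae_eq_of_ae_le_of_lintegral_le (hf.mono fun x hx => ENNReal.ofReal_le_ofReal
    (mul_le_mul_of_nonneg_right hx.2.le (by positivity : 0 ≤ |u x| ^ p)))
    (by rw [← ofReal_integral_eq_lintegral_ofReal hint h1]; exact ENNReal.ofReal_ne_top)
    (hf₂.1.aemeasurable.mul (hum.pow_const p)).ennreal_ofReal hle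
  refine hu_ne ?_
  filter_upwards [hae, hf] with x hx hfx
  have hup : 0 ≤ |u x| ^ p := by positivity
  rw [ENNReal.ofReal_eq_ofReal_iff (mul_nonneg hfx.1 hup)
    (mul_nonneg (hfx.1.trans hfx.2.le) hup)] at hx
  have h0 : |u x| ^ p = 0 := by
    by_contra hne
    exact hfx.2.ne (mul_right_cancel₀ hne hx)
  simpa using (Real.rpow_eq_zero (abs_nonneg _) hp0.ne').1 h0

end Comparison

/-! ### The comparison theorem -/

theorem mainTheorem3 (N : ℕ) (hN : 1 ≤ N) (Ω : Set (EuclideanSpace ℝ (Fin N)))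
    (hΩ_open : IsOpen Ω) (hΩ_conn : IsConnected Ω) (hΩ_bdd : Bornology.IsBounded Ω)
    (p s : ℝ) (hp : 1 < p)
    (w₁ w₂ : EuclideanSpace ℝ (Fin N) → ℝ)
    (hw₁ : IsWeightAp Ω p w₁) (hw₂ : IsWeightAs Ω p s w₂) (hps : (N : ℝ) < expPs p s)
    (hw : ∀ᵐ x ∂(volume.restrict Ω), w₂ x ≤ w₁ x)
    (f₁ f₂ : EuclideanSpace ℝ (Fin N) → ℝ)
    (hf₁ : IntegrableOn f₁ Ω volume) (hf₂ : IntegrableOn f₂ Ω volume)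
    (hf : ∀ᵐ x ∂(volume.restrict Ω), 0 ≤ f₁ x ∧ f₁ x < f₂ x)
    (u : EuclideanSpace ℝ (Fin N) → ℝ)
    (hu_nonneg : ∀ᵐ x ∂(volume.restrict Ω), 0 ≤ u x)
    (hu_ne : ¬ ∀ᵐ x ∂(volume.restrict Ω), u x = 0)
    (hu : IsDirichletSolution Ω p w₁ f₁ u)
    (v : EuclideanSpace ℝ (Fin N) → ℝ)
    (hv_ne : ¬ ∀ᵐ x ∂(volume.restrict Ω), v x = 0)
    (hv : IsDirichletSolution Ω p w₂ f₂ v) :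
    ChangesSign Ω v := by
  have hw₂' := hw₂.isWeightAp
  have hpre := hΩ_conn.isPreconnected
  have hmeas : ∀ P : ℝ → Prop, volume {x ∈ Ω | P (v x)} = 0 →
      ∀ᵐ x ∂(volume.restrict Ω), ¬ P (v x) := fun P hP => by
    rw [ae_restrict_iff' hΩ_open.measurableSet, ae_iff]
    refine measure_mono_null (fun x hx => ?_) hP
    simpa using hx
  refine ⟨pos_iff_ne_zero.2 fun h0 => ?_, pos_iff_ne_zero.2 fun h0 => ?_⟩
  -- If `v` is nowhere positive up to a null set, the odd symmetry of the equation makes `-v` a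
  -- nonnegative solution.
  · refine false_of_nonneg_solution hΩ_open hpre hΩ_bdd hp hw₁ hw₂' hw hf₂ hf hu_ne hu
      (by simpa using hv_ne) hv.neg ((hmeas _ h0).mono fun x hx => ?_)
    linarith
  · exact false_of_nonneg_solution hΩ_open hpre hΩ_bdd hp hw₁ hw₂' hw hf₂ hf hu_ne hu hv_ne hv
      ((hmeas (fun t => t < 0) h0).mono fun x hx => not_lt.1 hx)
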